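/- Let $K$ be an imaginary quadratic field with ring of integers $\mathcal{O}_K$ and discriminant $d_K$, and let $\rho_K$ be the residue at $s=1$ of the Dedekind zeta function of $K$. For a non-zero ideal $\mathfrak{a}$ of $\mathcal{O}_K$ put $N(\mathfrak{a})=|\mathcal{O}_K/\mathfrak{a}|$ and $\varphi(\mathfrak{a})=N(\mathfrak{a})\prod_{\mathfrak{p}\mid\mathfrak{a}}\bigl(1-\tfrac{1}{N(\mathfrak{p})}\bigr)$, the product being over the distinct prime ideals dividing $\mathfrak{a}$; for $\alpha\in\mathcal{O}_K\setminus\{0\}$ write $N(\alpha)=N((\alpha))$. Let $t\in\mathcal{O}_K$ be non-zero and not a unit. Then for every real number $u\ge 2\exp\left(8\cdot 10^{45}\,|d_K|\right)$, the set of prime elements $\alpha$ of $\mathcal{O}_K$ with $1\le N(\alpha)\le u$ such that $t\alpha+1$ is also a prime element of $\mathcal{O}_K$ is finite, and $$\#\{\alpha\in\mathcal{O}_K:\ 1\le N(\alpha)\le u,\ \alpha \text{ and } t\alpha+1 \text{ prime elements}\}\ \le\ \frac{2\cdot 10^{10}}{\sqrt{|d_K|}\,\rho_K^2}\cdot\frac{N(t)\,u}{\varphi((t))\,\log^2\!\left(\frac{u^{1/4}}{2}\right)}+10^{30}\,u^{3/4}.$$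 -/

import Mathlib

open NumberField

noncomputable section

/-- The generalized Euler function of an ideal of the ring of integers of a number field:
`φ(𝔞) = 𝔑𝔞 ∏_{𝔭 ∣ 𝔞} (1 - 1/𝔑𝔭)`, the product running over the distinct prime ideals
dividing `𝔞` (for `𝔞 ≠ 0`). -/
def idealEulerPhi (K : Type*) [Field K] [NumberField K] (a : Ideal (𝓞 K)) : ℝ :=
  (Ideal.absNorm a : ℝ) *
    ∏ P ∈ UniqueFactorizationMonoid.primeFactors a, (1 - 1 / (Ideal.absNorm P : ℝ))

/-- The norm `𝔑(α) = |𝓞_K / (α)|` of (the principal ideal of) an algebraic integer. -/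
def elementNorm (K : Type*) [Field K] [NumberField K] (α : 𝓞 K) : ℕ :=
  Ideal.absNorm (Ideal.span {α})

/-- The set of prime elements `α` of `𝓞_K` with `1 ≤ 𝔑(α) ≤ u` such that `tα + 1` is also a
prime element. -/
def primePairSet (K : Type*) [Field K] [NumberField K] (t : 𝓞 K) (u : ℝ) : Set (𝓞 K) :=
  {α | 1 ≤ (elementNorm K α : ℝ) ∧ (elementNorm K α : ℝ) ≤ u ∧ Prime α ∧ Prime (t * α + 1)}

end

/-! The proof is Selberg's upper-bound sieve for the polynomial X(tX + 1) on lattice points. Write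
𝓞_K = ℤ + ℤω and put w = u^(1/80). The elements of norm at most u lie in a box of about 16u/√|d_K|
points. If some prime 𝔭 of norm at most w² contains α(tα + 1), where α and tα + 1 are prime, then
N(α) ≤ 4w² (`elementNorm_le_of_mem_prime`), and such α fit in a small box. All other α survive the
sieve `selberg_sieve`, whose remainders come from the Chinese remainder theorem and residue counts
in a box (`abs_card_sifted_sub_le`).

The saving is a lower bound for the Selberg denominator G. No singular series is computed. Instead
`levelSum_mul_le` compares G at level w² with the square of a one-dimensional sum at level w: the
local inequality N²/(N - 1)² ≤ N/(N - 2) handles primes not dividing t, and the primes dividing t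
cost the factor N(t)/φ((t)). The one-dimensional sum, with weights 1/(N(𝔭) - 1), dominates the sum
of 1/N(𝔞) over ideals of norm at most w (`sum_absNorm_inv_le_levelSum`). That sum is at least ρ_K
log w/(64π) (`residue_mul_log_le_sum`), by counting in each ideal class and applying the class
number formula. Hence G is at least (ρ_K log w/(64π))² φ((t))/N(t).

A prime of norm 2 not containing t divides every α(tα + 1); the sifted set is then empty. -/

/-! ### Truncated sums over squarefree products -/

theorem one_le_prod_of_one_le {ι : Type*} {s : Finset ι} {N : ι → ℝ} (h : ∀ p ∈ s, 1 ≤ N p) :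
    1 ≤ ∏ p ∈ s, N p := by
  simpa using Finset.prod_le_prod (s := s) (f := fun _ => (1 : ℝ)) (fun _ _ => zero_le_one) h

/-- The subsets of `P` whose total norm is at most `z`. -/
noncomputable def levelSets {ι : Type*} (P : Finset ι) (N : ι → ℝ) (z : ℝ) : Finset (Finset ι) :=
  open Classical in P.powerset.filter fun D => ∏ p ∈ D, N p ≤ z

theorem mem_levelSets {ι : Type*} {P : Finset ι} {N : ι → ℝ} {z : ℝ} {D : Finset ι} :
    D ∈ levelSets P N z ↔ D ⊆ P ∧ ∏ p ∈ D, N p ≤ z := by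
  simp [levelSets]

/-- The truncated sum of a multiplicative function over squarefree products of elements of `P`. -/
noncomputable def levelSum {ι : Type*} (P : Finset ι) (N f : ι → ℝ) (z : ℝ) : ℝ :=
  ∑ D ∈ levelSets P N z, ∏ p ∈ D, f p

theorem levelSum_nonneg {ι : Type*} {P : Finset ι} {N f : ι → ℝ} (hf : ∀ p ∈ P, 0 ≤ f p) (z : ℝ) :
    0 ≤ levelSum P N f z :=
  Finset.sum_nonneg fun _ hD => Finset.prod_nonneg fun p hp => hf p ((mem_levelSets.1 hD).1 hp)

theorem levelSum_mono {ι : Type*} {P : Finset ι} {N f : ι → ℝ} (hf : ∀ p ∈ P, 0 ≤ f p)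
    {y z : ℝ} (hyz : y ≤ z) : levelSum P N f y ≤ levelSum P N f z := by
  refine Finset.sum_le_sum_of_subset_of_nonneg (fun D hD => ?_) fun D hD _ =>
    Finset.prod_nonneg fun p hp => hf p ((mem_levelSets.1 hD).1 hp)
  rw [mem_levelSets] at hD ⊢
  exact ⟨hD.1, hD.2.trans hyz⟩

theorem levelSum_insert {ι : Type*} [DecidableEq ι] {P : Finset ι} {N : ι → ℝ} (f : ι → ℝ) {q : ι}
    (hq : q ∉ P) (hN : 0 < N q) (z : ℝ) :
    levelSum (insert q P) N f z = levelSum P N f z + f q * levelSum P N f (z / N q) := by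
  unfold levelSum levelSets
  rw [Finset.sum_filter, Finset.sum_filter, Finset.sum_filter, Finset.sum_powerset_insert hq,
    Finset.mul_sum]
  congr 1
  refine Finset.sum_congr rfl fun D hD => ?_
  have hqD : q ∉ D := fun h => hq (Finset.mem_powerset.1 hD h)
  rw [Finset.prod_insert hqD, Finset.prod_insert hqD]
  simp only [le_div_iff₀ hN, mul_comm (N q), mul_ite, mul_zero]

theorem levelSum_empty {ι : Type*} (N f : ι → ℝ) (z : ℝ) :
    levelSum ∅ N f z = if 1 ≤ z then 1 else 0 := by
  unfold levelSum levelSets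
  rw [Finset.sum_filter]
  simp only [Finset.powerset_empty, Finset.sum_singleton, Finset.prod_empty]
  congr

/-- If `(1 + v)² ≤ (1 + h)(1 + c)` pointwise then the truncated sums of `v` are controlled by that
of `h` times the full product of `1 + c`. -/
theorem levelSum_mul_le {ι : Type*} (P : Finset ι) (N v h c : ι → ℝ)
    (hN : ∀ p ∈ P, 1 ≤ N p) (hv : ∀ p ∈ P, 0 ≤ v p) (hh : ∀ p ∈ P, 0 ≤ h p)
    (hc : ∀ p ∈ P, 0 ≤ c p) (hvh : ∀ p ∈ P, (1 + v p) ^ 2 ≤ (1 + h p) * (1 + c p))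
    {x y : ℝ} (hx : 0 ≤ x) (hy : 0 ≤ y) :
    levelSum P N v x * levelSum P N v y ≤ levelSum P N h (x * y) * ∏ p ∈ P, (1 + c p) := by
  classical
  induction P using Finset.induction_on generalizing x y with
  | empty =>
    simp only [levelSum_empty, Finset.prod_empty, mul_one]
    split_ifs with h1 h2 h3 h3 <;> try norm_num
    exact absurd (one_le_mul_of_one_le_of_one_le h1 h2) h3
  | insert q P hq ih =>
    have hNq := hN q (Finset.mem_insert_self q P)
    have hvq := hv q (Finset.mem_insert_self q P)
    have hhq := hh q (Finset.mem_insert_self q P)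
    have hcq := hc q (Finset.mem_insert_self q P)
    have hvhq := hvh q (Finset.mem_insert_self q P)
    have hhP : ∀ p ∈ P, 0 ≤ h p := fun p hp => hh p (Finset.mem_insert_of_mem hp)
    have hcP : ∀ p ∈ P, 0 ≤ c p := fun p hp => hc p (Finset.mem_insert_of_mem hp)
    have ih' : ∀ {x y : ℝ}, 0 ≤ x → 0 ≤ y →
        levelSum P N v x * levelSum P N v y ≤ levelSum P N h (x * y) * ∏ p ∈ P, (1 + c p) :=
      fun hx hy => ih (fun p hp => hN p (Finset.mem_insert_of_mem hp))
        (fun p hp => hv p (Finset.mem_insert_of_mem hp)) hhP hcP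
        (fun p hp => hvh p (Finset.mem_insert_of_mem hp)) hx hy
    have hN0 : 0 < N q := by linarith
    rw [levelSum_insert v hq hN0, levelSum_insert v hq hN0, levelSum_insert h hq hN0,
      Finset.prod_insert hq]
    have hx' : 0 ≤ x / N q := by positivity
    have hy' : 0 ≤ y / N q := by positivity
    have e1 := ih' hx hy
    have e2 := ih' hx' hy
    have e3 := ih' hx hy'
    have e4 := ih' hx' hy'
    rw [show x / N q * y = x * y / N q by ring] at e2
    rw [show x * (y / N q) = x * y / N q by ring] at e3
    have hC : 0 ≤ ∏ p ∈ P, (1 + c p) := Finset.prod_nonneg fun p hp => by linarith [hcP p hp]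
    have m1 : levelSum P N h (x * y / N q) ≤ levelSum P N h (x * y) :=
      levelSum_mono hhP (div_le_self (by positivity) hNq)
    -- The term with `q` in both factors is weakened from level `x * y / N q ^ 2` to `x * y / N q`.
    -- The terms then assemble into `G0 - G1 + (1 + v q) ^ 2 * G1`, to which the pointwise
    -- hypothesis applies.
    have m2 : levelSum P N h (x / N q * (y / N q)) ≤ levelSum P N h (x * y / N q) := by
      refine levelSum_mono hhP ?_
      rw [← mul_div_assoc, div_mul_eq_mul_div]
      exact div_le_self (by positivity) hNq
    set C := ∏ p ∈ P, (1 + c p)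
    set G0 := levelSum P N h (x * y)
    set G1 := levelSum P N h (x * y / N q)
    have hG1 : 0 ≤ G1 := levelSum_nonneg hhP _
    have e4' := e4.trans (mul_le_mul_of_nonneg_right m2 hC)
    have hm1 := mul_le_mul_of_nonneg_right m1 hC
    calc _ = levelSum P N v x * levelSum P N v y
          + v q * (levelSum P N v (x / N q) * levelSum P N v y)
          + v q * (levelSum P N v x * levelSum P N v (y / N q))
          + v q ^ 2 * (levelSum P N v (x / N q) * levelSum P N v (y / N q)) := by ring
      _ ≤ G0 * C + v q * (G1 * C) + v q * (G1 * C) + v q ^ 2 * (G1 * C) := by gcongr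
      _ = G0 * C - G1 * C + (1 + v q) ^ 2 * (G1 * C) := by ring
      _ ≤ G0 * C - G1 * C + (1 + h q) * (1 + c q) * (G1 * C) := by gcongr
      _ = G0 * C + c q * (G1 * C) + h q * (1 + c q) * (G1 * C) := by ring
      _ ≤ G0 * C + c q * (G0 * C) + h q * (1 + c q) * (G1 * C) := by gcongr
      _ = _ := by ring

/-! ### Selberg's upper-bound sieve on finite sets -/

/-- Möbius inversion on the subset lattice: removing `F` from each `D` leaves the alternating sum
over subsets of `E \ F`. It is used to invert the definition of the Selberg weights. -/
theorem sum_neg_one_pow_card_between {ι : Type*} [DecidableEq ι] (F E : Finset ι) :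
    ∑ D ∈ E.powerset with F ⊆ D, (-1 : ℝ) ^ D.card = if F = E then (-1) ^ F.card else 0 := by
  by_cases hFE : F ⊆ E
  · have : ∑ D ∈ E.powerset with F ⊆ D, (-1 : ℝ) ^ D.card
        = ∑ D ∈ (E \ F).powerset, (-1 : ℝ) ^ F.card * (-1) ^ D.card := by
      refine Finset.sum_nbij' (fun D => D \ F) (fun D => F ∪ D) ?_ ?_ ?_ ?_ ?_
      · intro D hD
        simp only [Finset.mem_filter, Finset.mem_powerset] at hD ⊢
        exact Finset.sdiff_subset_sdiff hD.1 le_rfl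
      · intro D hD
        simp only [Finset.mem_filter, Finset.mem_powerset] at hD ⊢
        exact ⟨Finset.union_subset hFE (hD.trans Finset.sdiff_subset), Finset.subset_union_left⟩
      · intro D hD
        simp only [Finset.mem_filter, Finset.mem_powerset] at hD
        exact Finset.union_sdiff_of_subset hD.2
      · intro D hD
        simp only [Finset.mem_powerset] at hD
        ext x
        have := @hD x
        simp only [Finset.mem_sdiff, Finset.mem_union] at this ⊢
        tauto
      · intro D hD
        simp only [Finset.mem_filter, Finset.mem_powerset] at hD
        rw [← pow_add, add_comm, Finset.card_sdiff_add_card_eq_card hD.2]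
    rw [this, ← Finset.mul_sum]
    have h2 := @Finset.sum_powerset_neg_one_pow_card ι _ (E \ F)
    have h3 : ∑ D ∈ (E \ F).powerset, (-1 : ℝ) ^ D.card = if E \ F = ∅ then 1 else 0 := by
      exact_mod_cast congrArg (Int.cast : ℤ → ℝ) h2
    simp only [h3, Finset.sdiff_eq_empty_iff_subset]
    by_cases h : F = E
    · simp [h]
    · rw [if_neg h, if_neg fun h' => h (hFE.antisymm h'), mul_zero]
  · rw [if_neg fun h => hFE h.subset]
    refine Finset.sum_eq_zero fun D hD => ?_
    simp only [Finset.mem_filter, Finset.mem_powerset] at hD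
    exact absurd (hD.2.trans hD.1) hFE

theorem levelSum_pos {ι : Type*} {P : Finset ι} {N g : ι → ℝ} {z : ℝ} (hg0 : ∀ p ∈ P, 0 < g p) (hg1 : ∀ p ∈ P, g p < 1) (hz : 1 ≤ z) :
    0 < levelSum P N (fun p => g p / (1 - g p)) z := by
  have h : ∀ D ∈ levelSets P N z, 0 ≤ ∏ p ∈ D, g p / (1 - g p) := fun D hD =>
    Finset.prod_nonneg fun p hp => div_nonneg (hg0 p ((mem_levelSets.1 hD).1 hp)).le
      (by linarith [hg1 p ((mem_levelSets.1 hD).1 hp)])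
  refine lt_of_lt_of_le one_pos ?_
  have := Finset.single_le_sum h (a := ∅) (by rw [mem_levelSets]; simpa using hz)
  simpa [levelSum] using this

section Selberg

variable {ι : Type*} [DecidableEq ι]

/-- The optimal Selberg weights. -/
noncomputable def selbergWeight (P : Finset ι) (N g : ι → ℝ) (z : ℝ) (D : Finset ι) : ℝ :=
  (-1) ^ D.card * (∏ p ∈ D, g p)⁻¹ *
    ((∑ E ∈ levelSets P N z with D ⊆ E, ∏ p ∈ E, g p / (1 - g p)) /
      levelSum P N (fun p => g p / (1 - g p)) z)

variable {P : Finset ι} {N g : ι → ℝ} {z : ℝ}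

theorem mem_levelSets_of_subset (hN : ∀ p ∈ P, 1 ≤ N p) {D E : Finset ι}
    (hE : E ∈ levelSets P N z) (hDE : D ⊆ E) : D ∈ levelSets P N z := by
  rw [mem_levelSets] at hE ⊢
  refine ⟨hDE.trans hE.1, le_trans ?_ hE.2⟩
  rw [← Finset.prod_sdiff hDE]
  have h1 := one_le_prod_of_one_le fun p (hp : p ∈ D) => hN p (hE.1 (hDE hp))
  have h2 := one_le_prod_of_one_le fun p (hp : p ∈ E \ D) => hN p (hE.1 (Finset.mem_sdiff.1 hp).1)
  exact le_mul_of_one_le_left (by linarith) h2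

theorem selbergWeight_empty (hg0 : ∀ p ∈ P, 0 < g p) (hg1 : ∀ p ∈ P, g p < 1) (hz : 1 ≤ z) :
    selbergWeight P N g z ∅ = 1 := by
  have := (levelSum_pos (N := N) hg0 hg1 hz).ne'
  simp only [selbergWeight, Finset.card_empty, pow_zero, Finset.prod_empty, inv_one, mul_one,
    one_mul, Finset.empty_subset, Finset.filter_true]
  exact div_self this

/-- The transformed Selberg weights. -/
theorem sum_selbergWeight_mul (hN : ∀ p ∈ P, 1 ≤ N p) (hg0 : ∀ p ∈ P, 0 < g p)
    {F : Finset ι} (hF : F ∈ levelSets P N z) :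
    ∑ D ∈ levelSets P N z with F ⊆ D, selbergWeight P N g z D * ∏ p ∈ D, g p =
      (-1) ^ F.card * (∏ p ∈ F, g p / (1 - g p)) /
        levelSum P N (fun p => g p / (1 - g p)) z := by
  set G := levelSum P N (fun p => g p / (1 - g p)) z
  have h1 : ∀ D ∈ (levelSets P N z).filter (F ⊆ ·), selbergWeight P N g z D * ∏ p ∈ D, g p =
      ∑ E ∈ levelSets P N z, if D ⊆ E then (-1) ^ D.card * ((∏ p ∈ E, g p / (1 - g p)) / G)
        else 0 := by
    intro D hD
    have hD' := (mem_levelSets.1 (Finset.mem_filter.1 hD).1).1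
    have hne : ∏ p ∈ D, g p ≠ 0 := Finset.prod_ne_zero_iff.2 fun p hp => (hg0 p (hD' hp)).ne'
    rw [selbergWeight, ← Finset.sum_filter, ← Finset.mul_sum, ← Finset.sum_div]
    field_simp
    rfl
  rw [Finset.sum_congr rfl h1, Finset.sum_comm]
  have h2 : ∀ E ∈ levelSets P N z, (∑ D ∈ levelSets P N z with F ⊆ D,
      if D ⊆ E then (-1 : ℝ) ^ D.card * ((∏ p ∈ E, g p / (1 - g p)) / G) else 0) =
      if F = E then (-1) ^ F.card * ((∏ p ∈ E, g p / (1 - g p)) / G) else 0 := by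
    intro E hE
    -- The level sets are closed under taking subsets, so `D` runs over the whole interval between
    -- `F` and `E` and Möbius inversion leaves only `E = F`.
    rw [← Finset.sum_filter, ← Finset.sum_mul, ← ite_zero_mul, ← sum_neg_one_pow_card_between]
    congr 1
    refine Finset.sum_congr ?_ fun _ _ => rfl
    ext D
    simp only [Finset.mem_filter, Finset.mem_powerset]
    exact ⟨fun h => ⟨h.2, h.1.2⟩, fun h => ⟨⟨mem_levelSets_of_subset hN hE h.1, h.2⟩, h.1⟩⟩
  rw [Finset.sum_congr rfl h2, Finset.sum_ite_eq, if_pos hF, mul_div_assoc]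

/-- Diagonalisation: the product of `g` over `D₁ ∪ D₂` is that over `D₁` times that over `D₂`,
divided by that over `D₁ ∩ D₂`. The last reciprocal expands as a sum of ∏ (1 - g)/g over subsets `F`
of the intersection. The form becomes a sum over `F` of squares already evaluated in
`sum_selbergWeight_mul`. -/
theorem selberg_quadratic_form (hN : ∀ p ∈ P, 1 ≤ N p) (hg0 : ∀ p ∈ P, 0 < g p)
    (hg1 : ∀ p ∈ P, g p < 1) (hz : 1 ≤ z) :
    ∑ D₁ ∈ levelSets P N z, ∑ D₂ ∈ levelSets P N z,
      selbergWeight P N g z D₁ * selbergWeight P N g z D₂ * ∏ p ∈ D₁ ∪ D₂, g p =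
      (levelSum P N (fun p => g p / (1 - g p)) z)⁻¹ := by
  set G := levelSum P N (fun p => g p / (1 - g p)) z with hG
  set S := levelSets P N z with hS
  set l := selbergWeight P N g z with hl
  have hSP : ∀ {D}, D ∈ S → D ⊆ P := fun hD => (mem_levelSets.1 hD).1
  have h1 : ∀ D₁ ∈ S, ∀ D₂ ∈ S, l D₁ * l D₂ * ∏ p ∈ D₁ ∪ D₂, g p =
      ∑ F ∈ S, if F ⊆ D₁ ∧ F ⊆ D₂ then (∏ p ∈ F, (1 - g p) / g p) *
        ((l D₁ * ∏ p ∈ D₁, g p) * (l D₂ * ∏ p ∈ D₂, g p)) else 0 := by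
    intro D₁ h₁ D₂ h₂
    have hfil : S.filter (fun F => F ⊆ D₁ ∧ F ⊆ D₂) = (D₁ ∩ D₂).powerset := by
      ext F
      simp only [Finset.mem_filter, Finset.mem_powerset, Finset.subset_inter_iff]
      exact ⟨fun h => h.2, fun h => ⟨mem_levelSets_of_subset hN h₁ h.1, h⟩⟩
    rw [← Finset.sum_filter, hfil, ← Finset.sum_mul, ← Finset.prod_one_add]
    have h3 : ∏ p ∈ D₁ ∩ D₂, (1 + (1 - g p) / g p) = (∏ p ∈ D₁ ∩ D₂, g p)⁻¹ := by
      rw [← Finset.prod_inv_distrib]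
      refine Finset.prod_congr rfl fun p hp => ?_
      have := (hg0 p (hSP h₁ (Finset.mem_inter.1 hp).1)).ne'
      field_simp
      ring
    have hne : ∏ p ∈ D₁ ∩ D₂, g p ≠ 0 := Finset.prod_ne_zero_iff.2 fun p hp =>
      (hg0 p (hSP h₁ (Finset.mem_inter.1 hp).1)).ne'
    have h4 := Finset.prod_union_inter (s₁ := D₁) (s₂ := D₂) (f := g)
    rw [h3]
    field_simp
    linear_combination (l D₁ * l D₂) * h4
  have h2 : ∑ D₁ ∈ S, ∑ D₂ ∈ S, l D₁ * l D₂ * ∏ p ∈ D₁ ∪ D₂, g p =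
      ∑ F ∈ S, (∏ p ∈ F, (1 - g p) / g p) * (∑ D ∈ S with F ⊆ D, l D * ∏ p ∈ D, g p) ^ 2 := by
    rw [Finset.sum_congr rfl fun D₁ h₁ => Finset.sum_congr rfl fun D₂ h₂ => h1 D₁ h₁ D₂ h₂]
    rw [Finset.sum_congr rfl fun D₁ h₁ => Finset.sum_comm, Finset.sum_comm]
    refine Finset.sum_congr rfl fun F _ => ?_
    rw [sq, Finset.sum_mul_sum, Finset.mul_sum, Finset.sum_filter]
    refine Finset.sum_congr rfl fun D₁ _ => ?_
    split_ifs with h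
    · simp only [h, true_and]
      rw [Finset.mul_sum, Finset.sum_filter]
    · simp [h]
  rw [h2]
  have hGp : 0 < G := levelSum_pos hg0 hg1 hz
  have h3 : ∀ F ∈ S, (∏ p ∈ F, (1 - g p) / g p) * (∑ D ∈ S with F ⊆ D, l D * ∏ p ∈ D, g p) ^ 2 =
      (∏ p ∈ F, g p / (1 - g p)) / G ^ 2 := by
    intro F hF
    rw [sum_selbergWeight_mul hN hg0 hF, ← hG, div_pow, mul_pow, ← pow_mul, mul_comm F.card,
      pow_mul, neg_one_sq, one_pow, one_mul, sq (∏ p ∈ F, g p / (1 - g p)), ← mul_div_assoc,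
      ← mul_assoc, ← Finset.prod_mul_distrib]
    rw [Finset.prod_congr rfl (g := fun _ => (1 : ℝ)), Finset.prod_const_one, one_mul]
    intro p hp
    have a := (hg0 p (hSP hF hp)).ne'
    have b : 1 - g p ≠ 0 := by linarith [hg1 p (hSP hF hp)]
    field_simp
  rw [Finset.sum_congr rfl h3, ← Finset.sum_div]
  change G / G ^ 2 = G⁻¹
  field_simp

/-- After exchanging sums, each `E` carries ∏ (1 + 1/g) ≤ ∏ (1 + N) ≤ ∏ N² ≤ z², where `2 ≤ N p`
gives the middle step; the remaining weights average to 1. The crude power of `z` is harmless since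
the sieve level will be a tiny power of `u`. -/
theorem sum_abs_selbergWeight_le (hN : ∀ p ∈ P, 2 ≤ N p) (hg0 : ∀ p ∈ P, 0 < g p)
    (hg1 : ∀ p ∈ P, g p < 1) (hgN : ∀ p ∈ P, (g p)⁻¹ ≤ N p) (hz : 1 ≤ z) :
    ∑ D ∈ levelSets P N z, |selbergWeight P N g z D| ≤ z ^ 2 := by
  set h : ι → ℝ := fun p => g p / (1 - g p) with hh
  set G := levelSum P N h z with hG
  set S := levelSets P N z with hS
  have hGp : 0 < G := levelSum_pos hg0 hg1 hz
  have hSP : ∀ {D}, D ∈ S → D ⊆ P := fun hD => (mem_levelSets.1 hD).1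
  have hN1 : ∀ p ∈ P, 1 ≤ N p := fun p hp => by linarith [hN p hp]
  have hpos : ∀ E ∈ S, 0 ≤ ∏ p ∈ E, h p := fun E hE => Finset.prod_nonneg fun p hp =>
    div_nonneg (hg0 p (hSP hE hp)).le (by linarith [hg1 p (hSP hE hp)])
  have h1 : ∀ D ∈ S, |selbergWeight P N g z D| = ∑ E ∈ S, if D ⊆ E then
      (∏ p ∈ D, (g p)⁻¹) * ((∏ p ∈ E, h p) / G) else 0 := by
    intro D hD
    rw [selbergWeight, abs_mul, abs_mul, abs_pow, abs_neg, abs_one, one_pow, one_mul,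
      ← Finset.sum_filter, ← Finset.mul_sum, ← Finset.sum_div, Finset.prod_inv_distrib]
    rw [abs_of_nonneg, abs_of_nonneg]
    · refine div_nonneg (Finset.sum_nonneg fun E hE => hpos E (Finset.mem_filter.1 hE).1) hGp.le
    · exact inv_nonneg.2 (Finset.prod_nonneg fun p hp => (hg0 p (hSP hD hp)).le)
  rw [Finset.sum_congr rfl h1, Finset.sum_comm]
  have h2 : ∀ E ∈ S, (∑ D ∈ S, if D ⊆ E then (∏ p ∈ D, (g p)⁻¹) * ((∏ p ∈ E, h p) / G) else 0) ≤
      z ^ 2 * ((∏ p ∈ E, h p) / G) := by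
    intro E hE
    have hfil : S.filter (· ⊆ E) = E.powerset := by
      ext F
      simp only [Finset.mem_filter, Finset.mem_powerset]
      exact ⟨fun h => h.2, fun h => ⟨mem_levelSets_of_subset hN1 hE h, h⟩⟩
    rw [← Finset.sum_filter, hfil, ← Finset.sum_mul, ← Finset.prod_one_add]
    refine mul_le_mul_of_nonneg_right ?_ (div_nonneg (hpos E hE) hGp.le)
    have hb : ∏ p ∈ E, (1 + (g p)⁻¹) ≤ ∏ p ∈ E, N p ^ 2 := by
      refine Finset.prod_le_prod (fun p hp => ?_) fun p hp => ?_
      · have := inv_nonneg.2 (hg0 p (hSP hE hp)).le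
        linarith
      · nlinarith [hN p (hSP hE hp), hgN p (hSP hE hp)]
    refine hb.trans ?_
    rw [Finset.prod_pow]
    have h0 : 0 ≤ ∏ p ∈ E, N p := Finset.prod_nonneg fun p hp => by linarith [hN p (hSP hE hp)]
    exact pow_le_pow_left₀ h0 (mem_levelSets.1 hE).2 2
  refine (Finset.sum_le_sum h2).trans ?_
  rw [← Finset.mul_sum, ← Finset.sum_div]
  change z ^ 2 * (G / G) ≤ z ^ 2
  rw [div_self hGp.ne', mul_one]

/-- **Selberg's upper bound sieve**, for a finite set `A` whose elements `a` are sifted by the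
finite sets `𝒟 a` of elements of `P`. -/
theorem selberg_sieve {β : Type*} (A : Finset β) (𝒟 : β → Finset ι)
    (hN : ∀ p ∈ P, 2 ≤ N p) (hg0 : ∀ p ∈ P, 0 < g p)
    (hg1 : ∀ p ∈ P, g p < 1) (hgN : ∀ p ∈ P, (g p)⁻¹ ≤ N p) (hz : 1 ≤ z) {X R : ℝ}
    (hR : ∀ D ⊆ P, ∏ p ∈ D, N p ≤ z ^ 2 →
      |((A.filter fun a => D ⊆ 𝒟 a).card : ℝ) - X * ∏ p ∈ D, g p| ≤ R) :
    ((A.filter fun a => 𝒟 a ∩ P = ∅).card : ℝ) ≤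
      X / levelSum P N (fun p => g p / (1 - g p)) z + z ^ 4 * R := by
  set S := levelSets P N z with hS
  set l := selbergWeight P N g z with hl
  have hN1 : ∀ p ∈ P, 1 ≤ N p := fun p hp => by linarith [hN p hp]
  have hSP : ∀ {D}, D ∈ S → D ⊆ P := fun hD => (mem_levelSets.1 hD).1
  have hR0 : 0 ≤ R := (abs_nonneg _).trans (hR ∅ (Finset.empty_subset _) (by
    simpa only [Finset.prod_empty] using one_le_pow₀ hz))
  -- A square is nonnegative, and for an unsifted `a` only `D = ∅`, of weight 1, contributes.
  have h1 : ((A.filter fun a => 𝒟 a ∩ P = ∅).card : ℝ) ≤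
      ∑ a ∈ A, (∑ D ∈ S, if D ⊆ 𝒟 a then l D else 0) ^ 2 := by
    rw [Finset.card_filter, Nat.cast_sum]
    refine Finset.sum_le_sum fun a _ => ?_
    split_ifs with h
    · have : ∑ D ∈ S, (if D ⊆ 𝒟 a then l D else 0) = 1 := by
        rw [Finset.sum_eq_single_of_mem ∅]
        · simpa using selbergWeight_empty hg0 hg1 hz
        · rw [mem_levelSets]
          simpa using hz
        · intro D hD hne
          rw [if_neg]
          intro hDa
          refine hne (Finset.subset_empty.1 ?_)
          rw [← h]
          exact Finset.subset_inter hDa (hSP hD)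
      rw [this]
      norm_num
    · rw [Nat.cast_zero]
      positivity
  refine h1.trans ?_
  have h2 : ∑ a ∈ A, (∑ D ∈ S, if D ⊆ 𝒟 a then l D else 0) ^ 2 =
      ∑ D₁ ∈ S, ∑ D₂ ∈ S, l D₁ * l D₂ * ((A.filter fun a => D₁ ∪ D₂ ⊆ 𝒟 a).card : ℝ) := by
    simp_rw [sq, Finset.sum_mul_sum, Finset.card_filter, Nat.cast_sum, Finset.mul_sum]
    rw [Finset.sum_comm]
    refine Finset.sum_congr rfl fun D₁ _ => ?_
    rw [Finset.sum_comm]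
    refine Finset.sum_congr rfl fun D₂ _ => Finset.sum_congr rfl fun a _ => ?_
    simp only [Finset.union_subset_iff]
    by_cases h₁ : D₁ ⊆ 𝒟 a <;> by_cases h₂ : D₂ ⊆ 𝒟 a <;> simp [h₁, h₂]
  have h3 : ∀ D₁ ∈ S, ∀ D₂ ∈ S, l D₁ * l D₂ * ((A.filter fun a => D₁ ∪ D₂ ⊆ 𝒟 a).card : ℝ) ≤
      X * (l D₁ * l D₂ * ∏ p ∈ D₁ ∪ D₂, g p) + |l D₁| * |l D₂| * R := by
    intro D₁ h₁ D₂ h₂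
    have hprod : ∏ p ∈ D₁ ∪ D₂, N p ≤ z ^ 2 := by
      have e1 := Finset.prod_union_inter (s₁ := D₁) (s₂ := D₂) (f := N)
      have e2 : 1 ≤ ∏ p ∈ D₁ ∩ D₂, N p :=
        one_le_prod_of_one_le fun p hp => hN1 p (hSP h₁ (Finset.mem_inter.1 hp).1)
      have e3 : 1 ≤ ∏ p ∈ D₁ ∪ D₂, N p :=
        one_le_prod_of_one_le fun p hp => hN1 p (Finset.union_subset (hSP h₁) (hSP h₂) hp)
      have e4 : 1 ≤ ∏ p ∈ D₁, N p := one_le_prod_of_one_le fun p hp => hN1 p (hSP h₁ hp)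
      have e5 : 1 ≤ ∏ p ∈ D₂, N p := one_le_prod_of_one_le fun p hp => hN1 p (hSP h₂ hp)
      have e6 := (mem_levelSets.1 h₁).2
      have e7 := (mem_levelSets.1 h₂).2
      calc _ ≤ (∏ p ∈ D₁ ∪ D₂, N p) * ∏ p ∈ D₁ ∩ D₂, N p := le_mul_of_one_le_right (by linarith) e2
        _ = (∏ p ∈ D₁, N p) * ∏ p ∈ D₂, N p := e1
        _ ≤ z * z := mul_le_mul e6 e7 (by linarith) (by linarith)
        _ = z ^ 2 := (sq z).symm
    have hr := hR (D₁ ∪ D₂) (Finset.union_subset (hSP h₁) (hSP h₂)) hprod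
    have hb : l D₁ * l D₂ * (((A.filter fun a => D₁ ∪ D₂ ⊆ 𝒟 a).card : ℝ)
        - X * ∏ p ∈ D₁ ∪ D₂, g p) ≤ |l D₁| * |l D₂| * R := by
      refine (le_abs_self _).trans ?_
      rw [abs_mul, abs_mul]
      exact mul_le_mul_of_nonneg_left hr (by positivity)
    linarith
  rw [h2]
  refine (Finset.sum_le_sum fun D₁ h₁ => Finset.sum_le_sum fun D₂ h₂ => h3 D₁ h₁ D₂ h₂).trans ?_
  simp_rw [Finset.sum_add_distrib, ← Finset.mul_sum]
  rw [selberg_quadratic_form hN1 hg0 hg1 hz, ← div_eq_mul_inv]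
  gcongr
  simp_rw [← Finset.sum_mul, ← Finset.mul_sum]
  rw [← Finset.sum_mul, ← sq]
  refine mul_le_mul_of_nonneg_right ?_ hR0
  rw [show z ^ 4 = (z ^ 2) ^ 2 by ring]
  exact pow_le_pow_left₀ (Finset.sum_nonneg fun _ _ => abs_nonneg _)
    (sum_abs_selbergWeight_le hN hg0 hg1 hgN hz) 2

end Selberg

/-! ### Harmonic sums over ideals and Euler products -/

section Ideals

variable {K : Type*} [Field K] [NumberField K]

theorem absNorm_eq_prod_primeFactors {a : Ideal (𝓞 K)} (ha : a ≠ 0) :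
    (Ideal.absNorm a : ℝ) = ∏ p ∈ UniqueFactorizationMonoid.primeFactors a,
      (Ideal.absNorm p : ℝ) ^ (UniqueFactorizationMonoid.normalizedFactors a).count p := by
  classical
  conv_lhs => rw [← Ideal.prod_normalizedFactors_eq_self ha]
  rw [map_multiset_prod, Finset.prod_multiset_map_count, Nat.cast_prod]
  simp only [Nat.cast_pow]
  refine Finset.prod_congr ?_ fun _ _ => rfl
  ext p
  simp [UniqueFactorizationMonoid.mem_primeFactors]

theorem mem_primeFactors_iff {a p : Ideal (𝓞 K)} (ha : a ≠ 0) :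
    p ∈ UniqueFactorizationMonoid.primeFactors a ↔ p.IsPrime ∧ a ≤ p := by
  rw [UniqueFactorizationMonoid.mem_primeFactors, Ideal.mem_normalizedFactors_iff ha]

theorem two_le_absNorm {p : Ideal (𝓞 K)} (hp : p.IsPrime) (hp0 : p ≠ ⊥) :
    2 ≤ Ideal.absNorm p := by
  have h1 : Ideal.absNorm p ≠ 1 := fun h => hp.ne_top (Ideal.absNorm_eq_one_iff.1 h)
  have h0 : Ideal.absNorm p ≠ 0 := fun h => hp0 (Ideal.absNorm_eq_zero_iff.1 h)
  omega

theorem sum_pow_inv_le {N : ℝ} (hN : 2 ≤ N) (M : ℕ) :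
    ∑ k ∈ Finset.Icc 1 M, (N ^ k)⁻¹ ≤ 1 / (N - 1) := by
  have h : ∑ k ∈ Finset.Icc 1 M, (N ^ k)⁻¹ = (1 - (N ^ M)⁻¹) / (N - 1) := by
    induction M with
    | zero => simp
    | succ m ih =>
      have : N - 1 ≠ 0 := by linarith
      have : N ≠ 0 := by linarith
      rw [Finset.sum_Icc_succ_top (by omega), ih]
      field_simp
      ring
  rw [h]
  have : 0 < N - 1 := by linarith
  have : 0 < (N ^ M)⁻¹ := by positivity
  gcongr
  linarith

/-- A finite sum of `1/𝔑𝔞` over ideals with given set of prime factors. -/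
theorem sum_absNorm_inv_fiber_le (A : Finset (Ideal (𝓞 K))) (F : Finset (Ideal (𝓞 K)))
    (hA : ∀ a ∈ A, a ≠ 0) (hAF : ∀ a ∈ A, UniqueFactorizationMonoid.primeFactors a = F)
    (hF : ∀ p ∈ F, p.IsPrime ∧ p ≠ ⊥) :
    ∑ a ∈ A, (Ideal.absNorm a : ℝ)⁻¹ ≤ ∏ p ∈ F, 1 / ((Ideal.absNorm p : ℝ) - 1) := by
  classical
  obtain ⟨M, hM⟩ : ∃ M : ℕ, ∀ a ∈ A, ∀ p,
      (UniqueFactorizationMonoid.normalizedFactors a).count p ≤ M := by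
    refine ⟨A.sup fun a => (UniqueFactorizationMonoid.normalizedFactors a).card, fun a ha p => ?_⟩
    exact (Multiset.count_le_card _ _).trans
      (Finset.le_sup (f := fun a => (UniqueFactorizationMonoid.normalizedFactors a).card) ha)
  calc ∑ a ∈ A, (Ideal.absNorm a : ℝ)⁻¹
      ≤ ∑ e ∈ F.pi fun _ => Finset.Icc 1 M,
          ∏ p ∈ F.attach, ((Ideal.absNorm p.1 : ℝ) ^ (e p.1 p.2))⁻¹ := by
        -- An ideal with prime set `F` is determined by its exponents, which lie in `[1, M]`; the
        -- sum over all such exponent vectors factors into geometric sums.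
        set Φ : Ideal (𝓞 K) → (p : Ideal (𝓞 K)) → p ∈ F → ℕ :=
          fun a p _ => (UniqueFactorizationMonoid.normalizedFactors a).count p with hΦ
        have hinj : Set.InjOn Φ A := by
          intro a ha b hb hab
          have hc : UniqueFactorizationMonoid.normalizedFactors a =
              UniqueFactorizationMonoid.normalizedFactors b := by
            ext p
            by_cases hp : p ∈ F
            · exact congrFun (congrFun hab p) hp
            · have h1 := hp
              have h2 := hp
              rw [← hAF a ha, UniqueFactorizationMonoid.mem_primeFactors] at h1
              rw [← hAF b hb, UniqueFactorizationMonoid.mem_primeFactors] at h2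
              rw [Multiset.count_eq_zero_of_notMem h1, Multiset.count_eq_zero_of_notMem h2]
          rw [← Ideal.prod_normalizedFactors_eq_self (hA a ha), hc,
            Ideal.prod_normalizedFactors_eq_self (hA b hb)]
        have hmaps : ∀ a ∈ A, Φ a ∈ F.pi fun _ => Finset.Icc 1 M := by
          intro a ha
          rw [Finset.mem_pi]
          intro p hp
          rw [Finset.mem_Icc]
          refine ⟨?_, hM a ha p⟩
          rw [← hAF a ha, UniqueFactorizationMonoid.mem_primeFactors] at hp
          exact Multiset.one_le_count_iff_mem.2 hp
        calc _ = ∑ e ∈ A.image Φ, ∏ p ∈ F.attach, ((Ideal.absNorm p.1 : ℝ) ^ (e p.1 p.2))⁻¹ := by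
              rw [Finset.sum_image hinj]
              refine Finset.sum_congr rfl fun a ha => ?_
              rw [absNorm_eq_prod_primeFactors (hA a ha), hAF a ha, ← Finset.prod_inv_distrib,
                ← Finset.prod_attach]
          _ ≤ _ := by
              refine Finset.sum_le_sum_of_subset_of_nonneg ?_ fun _ _ _ =>
                Finset.prod_nonneg fun _ _ => by positivity
              intro e he
              obtain ⟨a, ha, rfl⟩ := Finset.mem_image.1 he
              exact hmaps a ha
    _ = ∏ p ∈ F, ∑ k ∈ Finset.Icc 1 M, ((Ideal.absNorm p : ℝ) ^ k)⁻¹ := by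
        rw [Finset.prod_sum]
    _ ≤ _ := by
        refine Finset.prod_le_prod (fun p _ => Finset.sum_nonneg fun _ _ => by positivity)
          fun p hp => ?_
        exact sum_pow_inv_le (by exact_mod_cast two_le_absNorm (hF p hp).1 (hF p hp).2) M

/-- The harmonic sum over ideals of norm at most `y` is bounded by the truncated sum over
squarefree products of primes of `1/∏(𝔑𝔭 - 1)`. -/
theorem sum_absNorm_inv_le_levelSum (A P : Finset (Ideal (𝓞 K))) {y : ℝ}
    (hA : ∀ a ∈ A, a ≠ 0 ∧ (Ideal.absNorm a : ℝ) ≤ y)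
    (hP : ∀ p ∈ P, p.IsPrime ∧ p ≠ ⊥)
    (hPy : ∀ p : Ideal (𝓞 K), p.IsPrime → p ≠ ⊥ → (Ideal.absNorm p : ℝ) ≤ y → p ∈ P) :
    ∑ a ∈ A, (Ideal.absNorm a : ℝ)⁻¹ ≤
      levelSum P (fun p => (Ideal.absNorm p : ℝ)) (fun p => 1 / ((Ideal.absNorm p : ℝ) - 1)) y := by
  classical
  have hpa : ∀ a ∈ A, ∀ p ∈ UniqueFactorizationMonoid.primeFactors a,
      p.IsPrime ∧ p ≠ ⊥ ∧ a ≤ p := by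
    intro a ha p hp
    have := (mem_primeFactors_iff (hA a ha).1).1 hp
    refine ⟨this.1, ?_, this.2⟩
    rintro rfl
    exact (hA a ha).1 (le_bot_iff.1 this.2)
  have hmaps : ∀ a ∈ A, UniqueFactorizationMonoid.primeFactors a ∈
      levelSets P (fun p => (Ideal.absNorm p : ℝ)) y := by
    intro a ha
    rw [mem_levelSets]
    have ha0 : Ideal.absNorm a ≠ 0 := fun h => (hA a ha).1 (Ideal.absNorm_eq_zero_iff.1 h)
    constructor
    · intro p hp
      obtain ⟨h1, h2, h3⟩ := hpa a ha p hp
      refine hPy p h1 h2 (le_trans ?_ (hA a ha).2)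
      exact_mod_cast Nat.le_of_dvd (Nat.pos_of_ne_zero ha0) (Ideal.absNorm_dvd_absNorm_of_le h3)
    · refine le_trans ?_ (hA a ha).2
      rw [absNorm_eq_prod_primeFactors (hA a ha).1]
      refine Finset.prod_le_prod (fun _ _ => by positivity) fun p hp => ?_
      refine le_self_pow₀ ?_ ?_
      · have := two_le_absNorm (hpa a ha p hp).1 (hpa a ha p hp).2.1
        exact_mod_cast (by omega : 1 ≤ Ideal.absNorm p)
      · rw [UniqueFactorizationMonoid.mem_primeFactors] at hp
        have := Multiset.one_le_count_iff_mem.2 hp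
        omega
  -- Ideals are grouped by their set of prime divisors, whose norm product is at most the norm of
  -- the ideal.
  rw [← Finset.sum_fiberwise_of_maps_to hmaps]
  refine Finset.sum_le_sum fun F hF => ?_
  refine sum_absNorm_inv_fiber_le _ F (fun a ha => (hA a (Finset.mem_filter.1 ha).1).1)
    (fun a ha => (Finset.mem_filter.1 ha).2) fun p hp => hP p ((mem_levelSets.1 hF).1 hp)

end Ideals

/-! ### Norm, trace, integral basis and residue of an imaginary quadratic field -/

section ImaginaryQuadratic

variable {K : Type*} [Field K] [NumberField K]

/-- There is only one infinite place, of multiplicity two, so the product of local absolute values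
giving the norm has a single factor. -/
theorem elementNorm_eq_normSq (hdeg : Module.finrank ℚ K = 2) [him : IsTotallyComplex K]
    (φ : K →+* ℂ) (α : 𝓞 K) : (elementNorm K α : ℝ) = ‖φ α‖ ^ 2 := by
  classical
  have h1 := InfinitePlace.prod_eq_abs_norm (α : K)
  have hc : Fintype.card (InfinitePlace K) = 1 := by
    have := IsTotallyComplex.finrank (K := K)
    rw [InfinitePlace.card_eq_nrRealPlaces_add_nrComplexPlaces,
      IsTotallyComplex.nrRealPlaces_eq_zero]
    omega
  obtain ⟨w, hw⟩ := Fintype.card_eq_one_iff.1 hc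
  have hu : (Finset.univ : Finset (InfinitePlace K)) = {InfinitePlace.mk φ} := by
    ext v
    simp [hw v, hw (InfinitePlace.mk φ)]
  rw [hu, Finset.prod_singleton, IsTotallyComplex.mult_eq, InfinitePlace.apply] at h1
  rw [h1, elementNorm, Ideal.absNorm_span_singleton, Nat.cast_natAbs, Int.cast_abs,
    ← Algebra.coe_norm_int]
  simp

theorem trace_eq_two_mul_re (hdeg : Module.finrank ℚ K = 2) [him : IsTotallyComplex K]
    (φ : K →+* ℂ) (α : 𝓞 K) : ((Algebra.trace ℤ (𝓞 K) α : ℤ) : ℝ) = 2 * (φ α).re := by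
  classical
  have h1 := trace_eq_sum_embeddings (K := ℚ) (L := K) ℂ (x := (α : K))
  have hcard : Fintype.card (K →ₐ[ℚ] ℂ) = 2 := by rw [AlgHom.card, hdeg]
  set f : K →ₐ[ℚ] ℂ := RingHom.equivRatAlgHom K ℂ φ with hf
  set f' : K →ₐ[ℚ] ℂ := RingHom.equivRatAlgHom K ℂ (ComplexEmbedding.conjugate φ) with hf'
  have hne : f ≠ f' := by
    intro h
    have h2 : φ = ComplexEmbedding.conjugate φ := (RingHom.equivRatAlgHom K ℂ).injective h
    exact IsTotallyComplex.complexEmbedding_not_isReal φ h2.symm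
  have hu : (Finset.univ : Finset (K →ₐ[ℚ] ℂ)) = {f, f'} := by
    symm
    rw [← Finset.card_eq_iff_eq_univ, hcard, Finset.card_pair hne]
  rw [hu, Finset.sum_pair hne] at h1
  have h2 : f (α : K) + f' (α : K) = ((2 * (φ α).re : ℝ) : ℂ) := by
    rw [← Complex.add_conj]
    rfl
  rw [h2, ← Algebra.coe_trace_int] at h1
  have h3 : (((Algebra.trace ℤ (𝓞 K) α : ℤ) : ℝ) : ℂ) = ((2 * (φ α).re : ℝ) : ℂ) := by
    rw [← h1]
    simp
  exact_mod_cast h3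

/-- The ring of integers of an imaginary quadratic field has a `ℤ`-basis `1, ω` with `ω` in a
standard position. -/
theorem exists_generator (hdeg : Module.finrank ℚ K = 2) [him : IsTotallyComplex K]
    (φ : K →+* ℂ) : ∃ ω : 𝓞 K, (∀ α : 𝓞 K, ∃ x y : ℤ, α = x + y * ω) ∧ |(φ ω).re| ≤ 1 / 2 ∧
      4 * (φ ω).im ^ 2 = |(discr K : ℝ)| := by
  classical
  have hfr : Module.finrank ℤ (𝓞 K) = 2 := by rw [RingOfIntegers.rank, hdeg]
  let e : Module.Basis (Fin 2) ℤ (𝓞 K) := Module.finBasisOfFinrankEq ℤ (𝓞 K) hfr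
  set e₁ := e 0
  set e₂ := e 1
  have hrep : ∀ α : 𝓞 K, ∃ m n : ℤ, α = m * e₁ + n * e₂ := fun α => by
    refine ⟨e.repr α 0, e.repr α 1, ?_⟩
    conv_lhs => rw [← e.sum_repr α]
    simp [e₁, e₂]
  obtain ⟨a, b, hab⟩ := hrep 1
  -- The gcd of the coordinates of 1 divides 1 in 𝓞_K, so its norm, a square, is a unit of ℤ. Bézout
  -- coefficients then complete 1 to a ℤ-basis.
  have hcop : IsCoprime a b := by
    rw [Int.isCoprime_iff_gcd_eq_one]
    obtain ⟨a', ha'⟩ := Int.gcd_dvd_left (a := a) (b := b)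
    obtain ⟨b', hb'⟩ := Int.gcd_dvd_right (a := a) (b := b)
    set g := Int.gcd a b
    have h1 : (1 : 𝓞 K) = algebraMap ℤ (𝓞 K) g * (a' * e₁ + b' * e₂) := by
      rw [hab, ha', hb']
      push_cast
      ring
    have h2 : IsUnit (algebraMap ℤ (𝓞 K) g) := IsUnit.of_mul_eq_one _ h1.symm
    have h3 := h2.map (Algebra.norm ℤ)
    rw [Algebra.norm_algebraMap, hfr, isUnit_pow_iff two_ne_zero, Int.isUnit_iff] at h3
    omega
  obtain ⟨r, s, hrs⟩ := hcop
  have hrs' : (r : 𝓞 K) * a + s * b = 1 := by exact_mod_cast congrArg (Int.cast : ℤ → 𝓞 K) hrs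
  set ω₀ : 𝓞 K := -s * e₁ + r * e₂ with hω₀
  have he₁ : e₁ = r - b * ω₀ := by linear_combination -r * hab - e₁ * hrs'
  have he₂ : e₂ = s + a * ω₀ := by linear_combination -s * hab - e₂ * hrs'
  have him0 : 4 * (φ ω₀).im ^ 2 = |(discr K : ℝ)| := by
    have hd : (discr K : ℝ) = (Algebra.trace ℤ (𝓞 K) (e₁ * e₁) : ℤ) *
        (Algebra.trace ℤ (𝓞 K) (e₂ * e₂) : ℤ) - ((Algebra.trace ℤ (𝓞 K) (e₁ * e₂) : ℤ) : ℝ) ^ 2 := by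
      rw [← discr_eq_discr K e, Algebra.discr_def, Matrix.det_fin_two]
      simp only [Algebra.traceMatrix_apply, Algebra.traceForm_apply]
      push_cast
      rw [mul_comm (e 1) (e 0)]
      ring
    rw [trace_eq_two_mul_re hdeg φ, trace_eq_two_mul_re hdeg φ, trace_eq_two_mul_re hdeg φ] at hd
    have h1 : φ (1 : 𝓞 K) = a * φ e₁ + b * φ e₂ := by
      conv_lhs => rw [hab]
      simp
    have h2 : φ ω₀ = -s * φ e₁ + r * φ e₂ := by
      simp [hω₀]
    have hrsR : (r : ℝ) * a + s * b = 1 := by exact_mod_cast congrArg (Int.cast : ℤ → ℝ) hrs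
    simp only [map_one] at h1
    have h1r := congrArg Complex.re h1
    have h1i := congrArg Complex.im h1
    have h2i := congrArg Complex.im h2
    simp at h1r h1i h2i hd
    set x₁ := (φ e₁).re
    set y₁ := (φ e₁).im
    set x₂ := (φ e₂).re
    set y₂ := (φ e₂).im
    have h5 : (φ ω₀).im = x₁ * y₂ - x₂ * y₁ := by
      rw [h2i]
      linear_combination (-s * y₁ + r * y₂) * h1r - (-s * x₁ + r * x₂) * h1i
        + (x₁ * y₂ - x₂ * y₁) * hrsR
    have h6 : (discr K : ℝ) = -(4 * (φ ω₀).im ^ 2) := by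
      rw [hd, h5]
      ring
    rw [h6, abs_neg, abs_of_nonneg (by positivity)]
  -- Subtracting the nearest integer to the real part keeps the ℤ-span with 1 and the imaginary
  -- part.
  refine ⟨ω₀ - (round (φ ω₀).re : ℤ), fun α => ?_, ?_, ?_⟩
  · obtain ⟨m, n, h⟩ := hrep α
    refine ⟨m * r + n * s + (n * a - m * b) * round (φ ω₀).re, n * a - m * b, ?_⟩
    rw [h]
    push_cast
    linear_combination (m : 𝓞 K) * he₁ + n * he₂
  · have := abs_sub_round (φ ω₀).re
    simpa using this
  · rw [← him0]
    simp

theorem three_le_abs_discr (hdeg : Module.finrank ℚ K = 2) : 3 ≤ |(discr K : ℝ)| := by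
  have h : 3 ≤ |discr K| := abs_discr_gt_two (by omega)
  exact_mod_cast h

theorem card_units_eq_torsionOrder (hdeg : Module.finrank ℚ K = 2) [him : IsTotallyComplex K] :
    Nat.card (𝓞 K)ˣ = Units.torsionOrder K := by
  have htop : Units.torsion K = ⊤ := by
    rw [eq_top_iff]
    intro x _
    rw [Units.mem_torsion]
    intro w
    have h1 := elementNorm_eq_normSq hdeg w.embedding (x : 𝓞 K)
    have h2 : elementNorm K (x : 𝓞 K) = 1 := by
      rw [elementNorm, Ideal.absNorm_eq_one_iff, Ideal.span_singleton_eq_top]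
      exact x.isUnit
    rw [h2, Nat.cast_one, eq_comm, pow_eq_one_iff_of_nonneg (norm_nonneg _) two_ne_zero] at h1
    rwa [InfinitePlace.norm_embedding_eq] at h1
  rw [Units.torsionOrder, htop]
  simp

/-- The class number formula with unit rank 0: the regulator is an empty determinant, equal to 1,
and all units are roots of unity. -/
theorem residue_eq (hdeg : Module.finrank ℚ K = 2) [him : IsTotallyComplex K] :
    dedekindZeta_residue K = 2 * Real.pi * classNumber K /
      (Nat.card (𝓞 K)ˣ * Real.sqrt |(discr K : ℝ)|) := by
  have hnc : InfinitePlace.nrComplexPlaces K = 1 := by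
    have := IsTotallyComplex.finrank (K := K)
    omega
  have hrank : Units.rank K = 0 := by
    rw [Units.rank, InfinitePlace.card_eq_nrRealPlaces_add_nrComplexPlaces, hnc,
      IsTotallyComplex.nrRealPlaces_eq_zero]
  have hreg : Units.regulator K = 1 := by
    classical
    have : IsEmpty (Fin (Units.rank K)) := by
      rw [hrank]
      infer_instance
    rw [Units.regulator_eq_det']
    have : IsEmpty {w : InfinitePlace K // w ≠ Units.dirichletUnitTheorem.w₀} :=
      (Units.equivFinRank K).symm.isEmpty
    rw [Matrix.det_isEmpty, abs_one]
  rw [dedekindZeta_residue_def, hreg, hnc, IsTotallyComplex.nrRealPlaces_eq_zero,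
    card_units_eq_torsionOrder hdeg]
  simp

end ImaginaryQuadratic

/-! ### Residue classes in intervals and boxes -/

/-- The count is a difference of two ceilings whose arguments differ by L/n. The ceiling bounds are
strict on one side, which forces exactly one point when L = n. -/
theorem abs_card_residue_Ico_sub_le {n : ℕ} [NeZero n] (a : ℤ) (L : ℕ) (r : ZMod n) :
    |(((Finset.Ico a (a + L)).filter fun x : ℤ => (x : ZMod n) = r).card : ℝ) - L / n| ≤ 1 ∧
      (L = n → ((Finset.Ico a (a + L)).filter fun x : ℤ => (x : ZMod n) = r).card = 1) := by
  obtain ⟨v, rfl⟩ := ZMod.intCast_surjective r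
  have hn : (0 : ℤ) < n := by exact_mod_cast Nat.pos_of_ne_zero (NeZero.ne n)
  have hnq : (0 : ℚ) < n := by exact_mod_cast hn
  simp only [ZMod.intCast_eq_intCast_iff]
  have h := Int.Ico_filter_modEq_card a (a + L) hn v
  set c := ((Finset.Ico a (a + L)).filter fun x : ℤ => x ≡ v [ZMOD n]).card
  push_cast at h
  have hle : ⌈((a : ℚ) - v) / n⌉ ≤ ⌈((a : ℚ) + L - v) / n⌉ := by
    apply Int.ceil_mono
    gcongr
    linarith [(Nat.cast_nonneg L : (0 : ℚ) ≤ L)]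
  rw [max_eq_left (by linarith)] at h
  have hq : (c : ℚ) = ⌈((a : ℚ) + L - v) / n⌉ - ⌈((a : ℚ) - v) / n⌉ := by exact_mod_cast h
  have hsplit : ((a : ℚ) + L - v) / n = ((a : ℚ) - v) / n + L / n := by ring
  have h1 := Int.ceil_lt_add_one (((a : ℚ) + L - v) / n)
  have h2 := Int.le_ceil (((a : ℚ) + L - v) / n)
  have h3 := Int.ceil_lt_add_one (((a : ℚ) - v) / n)
  have h4 := Int.le_ceil (((a : ℚ) - v) / n)
  have hlow : (c : ℚ) - L / n ≤ 1 := by linarith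
  have hupp : -1 ≤ (c : ℚ) - L / n := by linarith
  have hlow' := (Rat.cast_le (K := ℝ)).2 hlow
  have hupp' := (Rat.cast_le (K := ℝ)).2 hupp
  push_cast at hlow' hupp'
  refine ⟨abs_le.2 ⟨hupp', hlow'⟩, fun hL => ?_⟩
  have : (L : ℚ) / n = 1 := by
    rw [hL]
    exact div_self hnq.ne'
  have h5 : (c : ℚ) < 2 := by linarith
  have h6 : 0 < (c : ℚ) := by linarith
  have h5' : c < 2 := by exact_mod_cast h5
  have h6' : 0 < c := by exact_mod_cast h6
  omega

section Classes

variable {A : Type*} [AddCommGroup A] [Finite A]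

/-- The number of points of a fibre of a surjection `ℤ² → A` is a sum over `n = |A|` residue pairs
modulo `n`. -/
theorem exists_residue_pairs {n : ℕ} [NeZero n] (hA : Nat.card A = n) (ψ : ℤ × ℤ →+ A)
    (hψ : Function.Surjective ψ) (v : A) : ∃ T : Finset (ZMod n × ZMod n), T.card = n ∧
      ∀ x y : ℤ, ψ (x, y) = v ↔ ((x : ZMod n), (y : ZMod n)) ∈ T := by
  classical
  have := Fintype.ofFinite A
  -- Since `n` kills `A`, the map factors through (ℤ/n)²; all fibres of the resulting surjection
  -- have n²/n = n elements.
  have hkill : ∀ w : A, (n : ℤ) • w = 0 := fun w => by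
    rw [natCast_zsmul, ← hA]
    exact card_nsmul_eq_zero'
  let f₁ : ZMod n →+ A := ZMod.lift n ⟨ψ.comp (AddMonoidHom.inl ℤ ℤ), by
    have : (AddMonoidHom.inl ℤ ℤ) (n : ℤ) = (n : ℤ) • ((1, 0) : ℤ × ℤ) := by simp
    rw [AddMonoidHom.comp_apply, this, map_zsmul, hkill]⟩
  let f₂ : ZMod n →+ A := ZMod.lift n ⟨ψ.comp (AddMonoidHom.inr ℤ ℤ), by
    have : (AddMonoidHom.inr ℤ ℤ) (n : ℤ) = (n : ℤ) • ((0, 1) : ℤ × ℤ) := by simp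
    rw [AddMonoidHom.comp_apply, this, map_zsmul, hkill]⟩
  let f : ZMod n × ZMod n →+ A := f₁.coprod f₂
  have hf : ∀ x y : ℤ, f ((x : ZMod n), (y : ZMod n)) = ψ (x, y) := by
    intro x y
    simp only [f, AddMonoidHom.coprod_apply, f₁, f₂, ZMod.lift_coe, AddMonoidHom.comp_apply]
    rw [← map_add]
    simp
  have hsurj : Function.Surjective f := fun w => by
    obtain ⟨⟨x, y⟩, hxy⟩ := hψ w
    exact ⟨_, (hf x y).trans hxy⟩
  refine ⟨Finset.univ.filter fun q => f q = v, ?_, fun x y => by simp [hf]⟩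
  have hcard : ∀ w, (Finset.univ.filter fun q => f q = w).card =
      (Finset.univ.filter fun q => f q = v).card := fun w =>
    AddMonoidHom.card_fiber_eq_of_mem_range f (hsurj w) (hsurj v)
  have h1 := Finset.card_eq_sum_card_fiberwise (f := f) (s := Finset.univ) (t := Finset.univ)
    (fun _ _ => Finset.mem_univ _)
  rw [Finset.sum_congr rfl fun w _ => hcard w, Finset.sum_const, Finset.card_univ,
    Finset.card_univ, Fintype.card_prod, ZMod.card, ← Nat.card_eq_fintype_card, hA,
    smul_eq_mul] at h1
  exact (Nat.eq_of_mul_eq_mul_left (Nat.pos_of_ne_zero (NeZero.ne n)) h1).symm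

/-- Each of the `n` residue pairs contributes a product of two interval counts, with error at most
L₁/n + L₂/n + 1. In an n × n box every product is exactly 1, which later gives exact counts of ideal
elements. -/
theorem card_box_class {n : ℕ} [NeZero n] (hA : Nat.card A = n) (ψ : ℤ × ℤ →+ A)
    (hψ : Function.Surjective ψ) (v : A) [DecidableEq A] (a b : ℤ) (L₁ L₂ : ℕ) :
    |(((Finset.Ico a (a + L₁) ×ˢ Finset.Ico b (b + L₂)).filter fun q => ψ q = v).card : ℝ) -
      L₁ * L₂ / n| ≤ L₁ + L₂ + n ∧
    (L₁ = n → L₂ = n →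
      ((Finset.Ico a (a + L₁) ×ˢ Finset.Ico b (b + L₂)).filter fun q => ψ q = v).card = n) := by
  obtain ⟨T, hT, hTψ⟩ := exists_residue_pairs hA ψ hψ v
  set c₁ : ZMod n → ℕ := fun r =>
    ((Finset.Ico a (a + L₁)).filter fun x : ℤ => (x : ZMod n) = r).card
  set c₂ : ZMod n → ℕ := fun r =>
    ((Finset.Ico b (b + L₂)).filter fun x : ℤ => (x : ZMod n) = r).card
  have hcount : ((Finset.Ico a (a + L₁) ×ˢ Finset.Ico b (b + L₂)).filter fun q => ψ q = v).card =
      ∑ q ∈ T, c₁ q.1 * c₂ q.2 := by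
    rw [Finset.card_eq_sum_card_fiberwise
      (f := fun q : ℤ × ℤ => ((q.1 : ZMod n), (q.2 : ZMod n))) (t := T)]
    · refine Finset.sum_congr rfl fun q hq => ?_
      rw [← Finset.card_product]
      congr 1
      ext ⟨x, y⟩
      simp only [Finset.mem_filter, Finset.mem_product, hTψ]
      constructor
      · rintro ⟨⟨⟨h1, h2⟩, h3⟩, rfl⟩
        exact ⟨⟨h1, rfl⟩, ⟨h2, rfl⟩⟩
      · rintro ⟨⟨h1, h2⟩, ⟨h3, h4⟩⟩
        have : ((x : ZMod n), (y : ZMod n)) = q := Prod.ext h2 h4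
        exact ⟨⟨⟨h1, h3⟩, this ▸ hq⟩, this⟩
    · rintro ⟨x, y⟩ hq
      exact (hTψ x y).1 (Finset.mem_filter.1 hq).2
  have hn : (0 : ℝ) < n := by exact_mod_cast Nat.pos_of_ne_zero (NeZero.ne n)
  rw [hcount]
  constructor
  · have hterm : ∀ q ∈ T, |((c₁ q.1 * c₂ q.2 : ℕ) : ℝ) - (L₁ / n) * (L₂ / n)| ≤
        L₁ / n + L₂ / n + 1 := by
      intro q _
      have h1 := (abs_card_residue_Ico_sub_le a L₁ q.1).1
      have h2 := (abs_card_residue_Ico_sub_le b L₂ q.2).1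
      change |(c₁ q.1 : ℝ) - L₁ / n| ≤ 1 at h1
      change |(c₂ q.2 : ℝ) - L₂ / n| ≤ 1 at h2
      push_cast
      have e1 : (0 : ℝ) ≤ L₁ / n := by positivity
      have e2 : (0 : ℝ) ≤ L₂ / n := by positivity
      rw [show (c₁ q.1 : ℝ) * c₂ q.2 - L₁ / n * (L₂ / n) =
        (c₁ q.1 - L₁ / n) * (c₂ q.2 - L₂ / n) + L₁ / n * (c₂ q.2 - L₂ / n) +
          (c₁ q.1 - L₁ / n) * (L₂ / n) by ring]
      refine (abs_add_three _ _ _).trans ?_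
      rw [abs_mul, abs_mul, abs_mul, abs_of_nonneg e1, abs_of_nonneg e2]
      have := mul_le_one₀ h1 (abs_nonneg _) h2
      nlinarith
    have h3 : ((∑ q ∈ T, c₁ q.1 * c₂ q.2 : ℕ) : ℝ) - L₁ * L₂ / n =
        ∑ q ∈ T, (((c₁ q.1 * c₂ q.2 : ℕ) : ℝ) - (L₁ / n) * (L₂ / n)) := by
      rw [Finset.sum_sub_distrib, Finset.sum_const, hT, nsmul_eq_mul, Nat.cast_sum]
      field_simp
    rw [h3]
    refine (Finset.abs_sum_le_sum_abs _ _).trans ((Finset.sum_le_sum hterm).trans ?_)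
    rw [Finset.sum_const, hT, nsmul_eq_mul]
    apply le_of_eq
    field_simp
  · intro h1 h2
    rw [Finset.sum_congr rfl (g := fun _ => 1), Finset.sum_const, hT, smul_eq_mul, mul_one]
    intro q _
    rw [show c₁ q.1 = 1 from (abs_card_residue_Ico_sub_le a L₁ q.1).2 h1,
      show c₂ q.2 = 1 from (abs_card_residue_Ico_sub_le b L₂ q.2).2 h2]

end Classes

/-! ### Local densities of X(tX + 1) -/

section Sifting

/-- The additive map `(x, y) ↦ x + yω`. -/
def latticeHom {K : Type*} [Field K] (ω : 𝓞 K) : ℤ × ℤ →+ 𝓞 K where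
  toFun q := q.1 + q.2 * ω
  map_zero' := by simp
  map_add' p q := by
    push_cast [Prod.fst_add, Prod.snd_add]
    ring

theorem latticeHom_apply {K : Type*} [Field K] (ω : 𝓞 K) (q : ℤ × ℤ) : latticeHom ω q = q.1 + q.2 * ω := rfl

/-- The number of roots of `X(tX + 1)` modulo a prime ideal. -/
noncomputable def rootCount {K : Type*} [Field K] (t : 𝓞 K) (p : Ideal (𝓞 K)) : ℕ :=
  open Classical in if t ∈ p then 1 else 2

theorem rootCount_pos {K : Type*} [Field K] (t : 𝓞 K) (p : Ideal (𝓞 K)) : 0 < rootCount t p := by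
  unfold rootCount
  split_ifs <;> omega

variable {K : Type*} [Field K] [NumberField K]

theorem natCard_quotient (p : Ideal (𝓞 K)) : Nat.card (𝓞 K ⧸ p) = Ideal.absNorm p := by
  rw [Ideal.absNorm_apply, Submodule.cardQuot_apply]

theorem natCard_roots (t : 𝓞 K) {p : Ideal (𝓞 K)} (hp : p.IsPrime) (hp0 : p ≠ ⊥) :
    Nat.card {r : 𝓞 K ⧸ p // r * (Ideal.Quotient.mk p t * r + 1) = 0} = rootCount t p := by
  have hmax : p.IsMaximal := hp.isMaximal hp0
  let _ := Ideal.Quotient.field p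
  set s : 𝓞 K ⧸ p := Ideal.Quotient.mk p t with hs
  unfold rootCount
  split_ifs with h
  · have hs0 : s = 0 := Ideal.Quotient.eq_zero_iff_mem.2 h
    have : {r : 𝓞 K ⧸ p | r * (s * r + 1) = 0} = {0} := by
      ext r
      simp [hs0]
    change Nat.card {r : 𝓞 K ⧸ p | r * (s * r + 1) = 0} = 1
    rw [this, Nat.card_coe_set_eq, Set.ncard_singleton]
  · have hs0 : s ≠ 0 := fun h' => h (Ideal.Quotient.eq_zero_iff_mem.1 h')
    have : {r : 𝓞 K ⧸ p | r * (s * r + 1) = 0} = {0, -s⁻¹} := by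
      ext r
      simp only [Set.mem_ofPred_eq, Set.mem_insert_iff, Set.mem_singleton_iff, mul_eq_zero]
      refine or_congr Iff.rfl ⟨fun h => ?_, fun h => ?_⟩
      · field_simp
        linear_combination h
      · rw [h]
        field_simp
        ring
    change Nat.card {r : 𝓞 K ⧸ p | r * (s * r + 1) = 0} = 2
    rw [this, Nat.card_coe_set_eq, Set.ncard_pair]
    rw [ne_eq, eq_comm, neg_eq_zero, inv_eq_zero]
    exact hs0

theorem rootCount_le_absNorm (t : 𝓞 K) {p : Ideal (𝓞 K)} (hp : p.IsPrime) (hp0 : p ≠ ⊥) :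
    rootCount t p ≤ Ideal.absNorm p := by
  have := two_le_absNorm hp hp0
  unfold rootCount
  split_ifs <;> omega

/-- The number of points of a box at which `α(tα + 1)` is divisible by each prime of `D`. -/
theorem abs_card_sifted_sub_le {ω : 𝓞 K} (hω : ∀ α : 𝓞 K, ∃ x y : ℤ, α = x + y * ω) (t : 𝓞 K)
    (D : Finset (Ideal (𝓞 K))) (hD : ∀ p ∈ D, p.IsPrime ∧ p ≠ ⊥) (a b : ℤ) (L₁ L₂ : ℕ)
    (B : Finset (ℤ × ℤ)) (hB : ∀ q, q ∈ B ↔ q ∈ Finset.Ico a (a + L₁) ×ˢ Finset.Ico b (b + L₂) ∧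
      ∀ p ∈ D, latticeHom ω q * (t * latticeHom ω q + 1) ∈ p) :
    |(B.card : ℝ) - L₁ * L₂ * ∏ p ∈ D, (rootCount t p : ℝ) / Ideal.absNorm p| ≤
      (∏ p ∈ D, (Ideal.absNorm p : ℝ)) * (L₁ + L₂ + ∏ p ∈ D, (Ideal.absNorm p : ℝ)) := by
  classical
  have hfin : ∀ p : D, Finite (𝓞 K ⧸ p.1) := fun p =>
    Ideal.finiteQuotientOfFreeOfNeBot p.1 (hD p.1 p.2).2
  have hft : ∀ p : D, Fintype (𝓞 K ⧸ p.1) := fun p => Fintype.ofFinite _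
  set n : ℕ := ∏ p ∈ D, Ideal.absNorm p with hn
  have hnpos : 0 < n := Finset.prod_pos fun p hp => by
    have := two_le_absNorm (hD p hp).1 (hD p hp).2
    omega
  have : NeZero n := ⟨hnpos.ne'⟩
  have hcard : Nat.card (∀ p : D, 𝓞 K ⧸ p.1) = n := by
    rw [Nat.card_pi, hn, ← Finset.prod_coe_sort D]
    simp only [natCard_quotient]
  let ψ : ℤ × ℤ →+ ∀ p : D, 𝓞 K ⧸ p.1 :=
    (RingHom.pi fun p : D => Ideal.Quotient.mk p.1).toAddMonoidHom.comp (latticeHom ω)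
  have hψa : ∀ q (p : D), ψ q p = Ideal.Quotient.mk p.1 (latticeHom ω q) := fun _ _ => rfl
  have hcop : Pairwise fun p q : D => IsCoprime p.1 q.1 := fun p q hpq => by
    have h1 := (hD p.1 p.2).1.isMaximal (hD p.1 p.2).2
    have h2 := (hD q.1 q.2).1.isMaximal (hD q.1 q.2).2
    exact Ideal.isCoprime_of_isMaximal fun h => hpq (Subtype.ext h)
  -- Chinese remainder theorem: distinct maximal ideals are pairwise coprime, and every element of
  -- 𝓞_K comes from a lattice point.
  have hψ : Function.Surjective ψ := by
    intro v
    obtain ⟨α', h⟩ := Ideal.quotientInfToPiQuotient_surj hcop v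
    obtain ⟨α, rfl⟩ := Ideal.Quotient.mk_surjective α'
    obtain ⟨x, y, hxy⟩ := hω α
    refine ⟨(x, y), ?_⟩
    rw [← h]
    funext p
    rw [hψa, latticeHom_apply, Ideal.quotientInfToPiQuotient_mk', ← hxy]
  set Ω : (p : D) → Finset (𝓞 K ⧸ p.1) := fun p =>
    Finset.univ.filter fun r => r * (Ideal.Quotient.mk p.1 t * r + 1) = 0 with hΩ
  set V : Finset (∀ p : D, 𝓞 K ⧸ p.1) := Fintype.piFinset Ω with hV
  have hVcard : V.card = ∏ p ∈ D, rootCount t p := by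
    rw [hV, Fintype.card_piFinset, ← Finset.prod_coe_sort D]
    refine Finset.prod_congr rfl fun p _ => ?_
    rw [← natCard_roots t (hD p.1 p.2).1 (hD p.1 p.2).2, Nat.card_eq_fintype_card,
      Fintype.card_subtype]
  have hmem : ∀ q, (∀ p ∈ D, latticeHom ω q * (t * latticeHom ω q + 1) ∈ p) ↔ ψ q ∈ V := by
    intro q
    simp only [hV, Fintype.mem_piFinset, hΩ, Finset.mem_filter, Finset.mem_univ, true_and, hψa,
      Subtype.forall]
    refine forall₂_congr fun p hp => ?_
    rw [← Ideal.Quotient.eq_zero_iff_mem]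
    simp
  have hBcard : B.card = ∑ v ∈ V,
      ((Finset.Ico a (a + L₁) ×ˢ Finset.Ico b (b + L₂)).filter fun q => ψ q = v).card := by
    rw [Finset.card_eq_sum_card_fiberwise (f := ψ) (t := V)]
    · refine Finset.sum_congr rfl fun v hv => ?_
      congr 1
      ext q
      rw [Finset.mem_filter, Finset.mem_filter, hB, hmem]
      constructor
      · rintro ⟨⟨h1, _⟩, h2⟩
        exact ⟨h1, h2⟩
      · rintro ⟨h1, h2⟩
        exact ⟨⟨h1, h2 ▸ hv⟩, h2⟩
    · intro q hq
      exact (hmem q).1 ((hB q).1 hq).2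
  have hnR : (∏ p ∈ D, (Ideal.absNorm p : ℝ)) = n := by
    rw [hn]
    push_cast
    rfl
  have hn0 : (0 : ℝ) < n := by exact_mod_cast hnpos
  have hVn : (V.card : ℝ) ≤ n := by
    rw [hVcard]
    exact_mod_cast Finset.prod_le_prod' fun p hp => rootCount_le_absNorm t (hD p hp).1 (hD p hp).2
  have heq : (B.card : ℝ) - L₁ * L₂ * ∏ p ∈ D, (rootCount t p : ℝ) / Ideal.absNorm p =
      ∑ v ∈ V, ((((Finset.Ico a (a + L₁) ×ˢ Finset.Ico b (b + L₂)).filter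
        fun q => ψ q = v).card : ℝ) - L₁ * L₂ / n) := by
    rw [Finset.sum_sub_distrib, Finset.sum_const, nsmul_eq_mul, hBcard, Nat.cast_sum,
      Finset.prod_div_distrib, hnR, hVcard]
    push_cast
    ring
  rw [heq, hnR]
  refine (Finset.abs_sum_le_sum_abs _ _).trans ?_
  refine (Finset.sum_le_sum fun v _ => (card_box_class hcard ψ hψ v a b L₁ L₂).1).trans ?_
  rw [Finset.sum_const, nsmul_eq_mul]
  exact mul_le_mul_of_nonneg_right hVn (by positivity)

end Sifting

/-! ### Lower bound for the harmonic sum over ideals -/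

section IdealHarmonicSum

variable {K : Type*} [Field K] [NumberField K]

theorem latticeHom_re_im (φ : K →+* ℂ) (ω : 𝓞 K) (q : ℤ × ℤ) :
    (φ (latticeHom ω q)).re = q.1 + q.2 * (φ ω).re ∧
      (φ (latticeHom ω q)).im = q.2 * (φ ω).im := by
  have : φ (latticeHom ω q) = (q.1 : ℂ) + q.2 * φ ω := by
    rw [latticeHom_apply]
    simp
  rw [this]
  simp

theorem latticeHom_injective (φ : K →+* ℂ) {ω : 𝓞 K} (h : (φ ω).im ≠ 0) :
    Function.Injective (latticeHom ω) := by
  rintro ⟨x, y⟩ ⟨x', y'⟩ hq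
  have h1 := latticeHom_re_im φ ω (x, y)
  have h2 := latticeHom_re_im φ ω (x', y')
  rw [hq] at h1
  have h3 := h1.2.symm.trans h2.2
  have h4 : (y : ℝ) = y' := mul_right_cancel₀ h h3
  have h5 := h1.1.symm.trans h2.1
  simp only [h4, add_left_inj] at h5
  exact Prod.ext (by exact_mod_cast h5) (by exact_mod_cast h4)

/-- The elements of a nonzero ideal `b` contribute at least a harmonic sum to the sum of
`1/𝔑(α)`. -/
theorem exists_finset_mem_ideal (hdeg : Module.finrank ℚ K = 2) [him : IsTotallyComplex K]
    (φ : K →+* ℂ) {ω : 𝓞 K} (hω : ∀ α : 𝓞 K, ∃ x y : ℤ, α = x + y * ω)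
    (him0 : (φ ω).im ≠ 0) {q : ℕ} (hq : ‖φ ω‖ ≤ q) {b : Ideal (𝓞 K)} (hb : b ≠ ⊥) (k₀ : ℕ) :
    ∃ S : Finset (𝓞 K), (∀ α ∈ S, α ∈ b ∧ α ≠ 0 ∧
      (elementNorm K α : ℝ) ≤ 4 * (Ideal.absNorm b) ^ 2 * k₀ ^ 2 * q ^ 2) ∧
      (∑ k ∈ Finset.range k₀, ((k : ℝ) + 1)⁻¹) / (4 * Ideal.absNorm b * q) ≤
        ∑ α ∈ S, (elementNorm K α : ℝ)⁻¹ := by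
  classical
  set n := Ideal.absNorm b with hn
  have hn0 : n ≠ 0 := fun h => hb (Ideal.absNorm_eq_zero_iff.1 h)
  have : NeZero n := ⟨hn0⟩
  have hnpos : (0 : ℝ) < n := by exact_mod_cast Nat.pos_of_ne_zero hn0
  have hqpos : (0 : ℝ) < q := by
    refine lt_of_lt_of_le ?_ hq
    rw [norm_pos_iff]
    intro h
    exact him0 (by rw [h, Complex.zero_im])
  have := Ideal.finiteQuotientOfFreeOfNeBot b hb
  set ψ : ℤ × ℤ →+ 𝓞 K ⧸ b :=
    ((Ideal.Quotient.mk b : 𝓞 K →+* 𝓞 K ⧸ b) : 𝓞 K →+ 𝓞 K ⧸ b).comp (latticeHom ω) with hψ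
  have hψs : Function.Surjective ψ := fun v => by
    obtain ⟨α, rfl⟩ := Ideal.Quotient.mk_surjective v
    obtain ⟨x, y, hxy⟩ := hω α
    exact ⟨(x, y), by rw [hxy]; rfl⟩
  have hψ0 : ∀ p, ψ p = 0 ↔ latticeHom ω p ∈ b := fun p => Ideal.Quotient.eq_zero_iff_mem
  -- The open positive quadrant is tiled by n × n blocks, each with exactly `n` points of `b`; the
  -- shift by 1 keeps both coordinates positive, so the elements are nonzero.
  set blk : ℕ × ℕ → Finset (ℤ × ℤ) := fun j =>
    (Finset.Ico ((n * j.1 + 1 : ℕ) : ℤ) ((n * j.1 + 1 : ℕ) + n) ×ˢ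
      Finset.Ico ((n * j.2 + 1 : ℕ) : ℤ) ((n * j.2 + 1 : ℕ) + n)).filter fun p => ψ p = 0
    with hblk
  have hblkcard : ∀ j, (blk j).card = n := fun j =>
    (card_box_class (natCard_quotient b) ψ hψs 0 _ _ n n).2 rfl rfl
  have hblkmem : ∀ j p, p ∈ blk j → (n * j.1 < p.1 ∧ p.1 ≤ n * j.1 + n) ∧
      (n * j.2 < p.2 ∧ p.2 ≤ n * j.2 + n) ∧ latticeHom ω p ∈ b := by
    intro j p hp
    simp only [hblk, Finset.mem_filter, Finset.mem_product, Finset.mem_Ico, hψ0] at hp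
    push_cast at hp
    refine ⟨⟨?_, ?_⟩, ⟨?_, ?_⟩, hp.2⟩ <;> linarith [hp.1.1.1, hp.1.1.2, hp.1.2.1, hp.1.2.2]
  have hidx : ∀ i i' : ℕ, ∀ x : ℤ, n * i < x → x ≤ n * i + n → n * i' < x → x ≤ n * i' + n →
      i = i' := by
    have key : ∀ i i' : ℕ, ∀ x : ℤ, x ≤ n * i + n → n * i' < x → i' ≤ i := by
      intro i i' x h1 h2
      by_contra h
      have h3 : (i : ℤ) + 1 ≤ i' := by omega
      nlinarith
    intro i i' x h1 h2 h3 h4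
    exact le_antisymm (key i' i x h4 h1) (key i i' x h2 h3)
  have hnorm : ∀ j p, j.1 + 1 ≤ (j.2 + 1) * q → p ∈ blk j → 0 < elementNorm K (latticeHom ω p) ∧
      (elementNorm K (latticeHom ω p) : ℝ) ≤ 4 * n ^ 2 * ((j.2 : ℝ) + 1) ^ 2 * q ^ 2 := by
    intro j p hj hp
    obtain ⟨⟨h1, h2⟩, ⟨h3, h4⟩, -⟩ := hblkmem j p hp
    have hp1 : (0 : ℤ) < p.1 := lt_of_le_of_lt (by positivity) h1
    have hp2 : (0 : ℤ) < p.2 := lt_of_le_of_lt (by positivity) h3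
    have h2' : (p.1 : ℝ) ≤ n * j.1 + n := by exact_mod_cast h2
    have h4' : (p.2 : ℝ) ≤ n * j.2 + n := by exact_mod_cast h4
    have hp1' : (0 : ℝ) < p.1 := by exact_mod_cast hp1
    have hp2' : (0 : ℝ) < p.2 := by exact_mod_cast hp2
    have hN := elementNorm_eq_normSq hdeg φ (latticeHom ω p)
    constructor
    · have hne : φ (latticeHom ω p) ≠ 0 := by
        intro h
        have := (latticeHom_re_im φ ω p).2
        rw [h, Complex.zero_im, eq_comm, mul_eq_zero] at this
        rcases this with h' | h'
        · exact hp2'.ne' h'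
        · exact him0 h'
      have : (0 : ℝ) < elementNorm K (latticeHom ω p) := by
        rw [hN]
        have := norm_pos_iff.2 hne
        positivity
      exact_mod_cast this
    · have hjR : (j.1 : ℝ) + 1 ≤ (j.2 + 1) * q := by exact_mod_cast hj
      have hle : ‖φ (latticeHom ω p)‖ ≤ 2 * n * (j.2 + 1) * q := by
        have : φ (latticeHom ω p) = (p.1 : ℂ) + p.2 * φ ω := by
          rw [latticeHom_apply]
          simp
        rw [this]
        refine (norm_add_le _ _).trans ?_
        rw [norm_mul, Complex.norm_intCast, Complex.norm_intCast, abs_of_pos hp1', abs_of_pos hp2']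
        have e1 : (p.2 : ℝ) * ‖φ ω‖ ≤ (n * j.2 + n) * q :=
          mul_le_mul h4' hq (norm_nonneg _) (by positivity)
        nlinarith
      rw [hN]
      calc _ ≤ (2 * n * ((j.2 : ℝ) + 1) * q) ^ 2 := pow_le_pow_left₀ (norm_nonneg _) hle 2
        _ = _ := by ring
  -- Row k uses (k + 1)q blocks, on which norms are at most (2n(k + 1)q)². It contributes at least
  -- (k + 1)q · n / (2n(k + 1)q)² = 1/(4nq(k + 1)).
  set J : Finset (ℕ × ℕ) := (Finset.range k₀).biUnion fun k =>
    (Finset.range ((k + 1) * q)).image fun i => (i, k) with hJ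
  have hJmem : ∀ j ∈ J, j.2 < k₀ ∧ j.1 + 1 ≤ (j.2 + 1) * q := by
    intro j hj
    simp only [hJ, Finset.mem_biUnion, Finset.mem_range, Finset.mem_image] at hj
    obtain ⟨k, hk, i, hi, rfl⟩ := hj
    exact ⟨hk, hi⟩
  refine ⟨(J.biUnion blk).image (latticeHom ω), ?_, ?_⟩
  · intro α hα
    obtain ⟨p, hp, rfl⟩ := Finset.mem_image.1 hα
    obtain ⟨j, hj, hpj⟩ := Finset.mem_biUnion.1 hp
    obtain ⟨hj2, hj1⟩ := hJmem j hj
    obtain ⟨h1, h2⟩ := hnorm j p hj1 hpj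
    refine ⟨(hblkmem j p hpj).2.2, ?_, h2.trans ?_⟩
    · intro h
      rw [h, elementNorm] at h1
      simp at h1
    · have : (j.2 : ℝ) + 1 ≤ k₀ := by exact_mod_cast hj2
      gcongr
  · rw [Finset.sum_image ((latticeHom_injective φ him0).injOn), Finset.sum_biUnion]
    · have hterm : ∀ j ∈ J, (4 * n * ((j.2 : ℝ) + 1) ^ 2 * q ^ 2)⁻¹ ≤
          ∑ p ∈ blk j, (elementNorm K (latticeHom ω p) : ℝ)⁻¹ := by
        intro j hj
        have : ∑ p ∈ blk j, (4 * n ^ 2 * ((j.2 : ℝ) + 1) ^ 2 * q ^ 2)⁻¹ ≤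
            ∑ p ∈ blk j, (elementNorm K (latticeHom ω p) : ℝ)⁻¹ := by
          refine Finset.sum_le_sum fun p hp => ?_
          obtain ⟨h1, h2⟩ := hnorm j p (hJmem j hj).2 hp
          have : (0 : ℝ) < elementNorm K (latticeHom ω p) := by exact_mod_cast h1
          gcongr
        refine le_trans (le_of_eq ?_) this
        rw [Finset.sum_const, hblkcard, nsmul_eq_mul]
        field_simp
      refine le_trans (le_of_eq ?_) (Finset.sum_le_sum hterm)
      rw [hJ, Finset.sum_biUnion, Finset.sum_div]
      · refine Finset.sum_congr rfl fun k _ => ?_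
        rw [Finset.sum_image fun _ _ _ _ h => (Prod.ext_iff.1 h).1]
        simp only [Finset.sum_const, Finset.card_range, nsmul_eq_mul]
        push_cast
        field_simp
      · intro k _ k' _ hkk
        rw [Function.onFun, Finset.disjoint_left]
        intro j hj hj'
        simp only [Finset.mem_image, Finset.mem_range] at hj hj'
        obtain ⟨i, _, rfl⟩ := hj
        obtain ⟨i', _, h⟩ := hj'
        exact hkk (Prod.ext_iff.1 h).2.symm
    · intro j _ j' _ hjj
      rw [Function.onFun, Finset.disjoint_left]
      intro p hp hp'
      obtain ⟨⟨h1, h2⟩, ⟨h3, h4⟩, -⟩ := hblkmem j p hp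
      obtain ⟨⟨h1', h2'⟩, ⟨h3', h4'⟩, -⟩ := hblkmem j' p hp'
      exact hjj (Prod.ext (hidx _ _ _ h1 h2 h1' h2') (hidx _ _ _ h3 h4 h3' h4'))

open nonZeroDivisors in
/-- Passing from elements of `b` to ideals in the class inverse to that of `b`. -/
theorem sum_elementNorm_inv_le (hdeg : Module.finrank ℚ K = 2) [him : IsTotallyComplex K]
    (b : (Ideal (𝓞 K))⁰) (S : Finset (𝓞 K)) (hS : ∀ α ∈ S, α ∈ (b : Ideal (𝓞 K)) ∧ α ≠ 0)
    (A : Finset (Ideal (𝓞 K))⁰)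
    (hA : ∀ a : (Ideal (𝓞 K))⁰, ClassGroup.mk0 a = (ClassGroup.mk0 b)⁻¹ →
      (∃ α ∈ S, Ideal.absNorm (b : Ideal (𝓞 K)) * Ideal.absNorm (a : Ideal (𝓞 K)) =
        elementNorm K α) → a ∈ A) :
    Ideal.absNorm (b : Ideal (𝓞 K)) * ∑ α ∈ S, (elementNorm K α : ℝ)⁻¹ ≤
      Nat.card (𝓞 K)ˣ * ∑ a ∈ A, (Ideal.absNorm (a : Ideal (𝓞 K)) : ℝ)⁻¹ := by
  classical
  have hcard0 : Nat.card (𝓞 K)ˣ ≠ 0 := by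
    rw [card_units_eq_torsionOrder hdeg]
    exact Units.torsionOrder_ne_zero K
  have hfin : Finite (𝓞 K)ˣ := Nat.finite_of_card_ne_zero hcard0
  have := Fintype.ofFinite (𝓞 K)ˣ
  have hex : ∀ α : 𝓞 K, ∃ a : (Ideal (𝓞 K))⁰, α ∈ S →
      Ideal.span {α} = (b : Ideal (𝓞 K)) * (a : Ideal (𝓞 K)) := by
    intro α
    by_cases hα : α ∈ S
    · obtain ⟨a, ha⟩ := Ideal.dvd_iff_le.2 ((Ideal.span_singleton_le_iff_mem _).2 (hS α hα).1)
      refine ⟨⟨a, mem_nonZeroDivisors_iff_ne_zero.2 ?_⟩, fun _ => ha⟩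
      rintro rfl
      rw [mul_zero, Ideal.zero_eq_bot, Ideal.span_singleton_eq_bot] at ha
      exact (hS α hα).2 ha
    · exact ⟨1, fun h => absurd h hα⟩
  choose f hf using hex
  have hfN : ∀ α ∈ S, Ideal.absNorm (b : Ideal (𝓞 K)) * Ideal.absNorm (f α : Ideal (𝓞 K)) =
      elementNorm K α := fun α hα => by
    rw [elementNorm, hf α hα, map_mul]
  have hmaps : ∀ α ∈ S, f α ∈ A := fun α hα => by
    refine hA _ (ClassGroup.mk0_eq_mk0_inv_iff.2 ⟨α, (hS α hα).2, ?_⟩) ⟨α, hα, hfN α hα⟩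
    rw [hf α hα, mul_comm]
  have hb0 : (Ideal.absNorm (b : Ideal (𝓞 K)) : ℝ) ≠ 0 := by
    exact_mod_cast fun h => nonZeroDivisors.coe_ne_zero b (Ideal.absNorm_eq_zero_iff.1 h)
  have h1 : Ideal.absNorm (b : Ideal (𝓞 K)) * ∑ α ∈ S, (elementNorm K α : ℝ)⁻¹ =
      ∑ a ∈ A, ∑ α ∈ S with f α = a, (Ideal.absNorm (a : Ideal (𝓞 K)) : ℝ)⁻¹ := by
    rw [Finset.mul_sum, ← Finset.sum_fiberwise_of_maps_to hmaps]
    refine Finset.sum_congr rfl fun a _ => Finset.sum_congr rfl fun α hα => ?_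
    obtain ⟨hαS, rfl⟩ := Finset.mem_filter.1 hα
    rw [← hfN α hαS, Nat.cast_mul, mul_inv, ← mul_assoc, mul_inv_cancel₀ hb0, one_mul]
  rw [h1, Finset.mul_sum]
  refine Finset.sum_le_sum fun a _ => ?_
  rw [Finset.sum_const, nsmul_eq_mul]
  refine mul_le_mul_of_nonneg_right ?_ (by positivity)
  norm_cast
  rcases Finset.eq_empty_or_nonempty (S.filter fun α => f α = a) with h | ⟨α₀, hα₀⟩
  · rw [h]
    simp
  -- Elements giving the same ideal `a` generate the same principal ideal, so they differ by units.
  · have hsub : (S.filter fun α => f α = a) ⊆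
        Finset.image (fun u : (𝓞 K)ˣ => α₀ * (u : 𝓞 K)) Finset.univ := by
      intro α hα
      obtain ⟨h2, h3⟩ := Finset.mem_filter.1 hα
      obtain ⟨h4, h5⟩ := Finset.mem_filter.1 hα₀
      have h6 : Ideal.span {α₀} = Ideal.span {α} := by
        rw [hf α h2, hf α₀ h4, h3, h5]
      obtain ⟨u, hu⟩ := Ideal.span_singleton_eq_span_singleton.1 h6
      exact Finset.mem_image.2 ⟨u, Finset.mem_univ _, hu⟩
    rw [Nat.card_eq_fintype_card]
    exact (Finset.card_le_card hsub).trans Finset.card_image_le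

-- For each class C, Minkowski's bound provides `b` in C⁻¹ of norm at most `q`, and the elements of
-- `b` produce the ideals of C. The factor N(b) cancels, so every class contributes the same amount,
-- and there are `classNumber K` classes.
open nonZeroDivisors in
theorem classNumber_mul_harmonic_le (hdeg : Module.finrank ℚ K = 2) [him : IsTotallyComplex K]
    {q : ℕ} (hq : Real.sqrt |(discr K : ℝ)| ≤ q) (k₀ : ℕ) (A : Finset (Ideal (𝓞 K))⁰)
    (hA : ∀ a : (Ideal (𝓞 K))⁰,
      (Ideal.absNorm (a : Ideal (𝓞 K)) : ℝ) ≤ 4 * q ^ 3 * k₀ ^ 2 → a ∈ A) :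
    classNumber K * (∑ k ∈ Finset.range k₀, ((k : ℝ) + 1)⁻¹) / (4 * q) ≤
      Nat.card (𝓞 K)ˣ * ∑ a ∈ A, (Ideal.absNorm (a : Ideal (𝓞 K)) : ℝ)⁻¹ := by
  classical
  have hd := three_le_abs_discr (K := K) hdeg
  set d := |(discr K : ℝ)|
  let φ : K →+* ℂ := Classical.choice inferInstance
  obtain ⟨ω, hω, hre, him1⟩ := exists_generator hdeg φ
  have him0 : (φ ω).im ≠ 0 := by
    intro h
    rw [h] at him1
    change _ = d at him1
    norm_num at him1
    linarith
  have hqpos : (0 : ℝ) < q := lt_of_lt_of_le (Real.sqrt_pos.2 (by linarith)) hq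
  have hq2 : d ≤ (q : ℝ) ^ 2 := (Real.sqrt_le_left hqpos.le).1 hq
  have hωq : ‖φ ω‖ ≤ q := by
    refine le_of_sq_le_sq ?_ hqpos.le
    rw [Complex.sq_norm, Complex.normSq_apply]
    change _ = d at him1
    have := sq_abs (φ ω).re
    nlinarith [abs_nonneg (φ ω).re]
  set H := ∑ k ∈ Finset.range k₀, ((k : ℝ) + 1)⁻¹
  have hclass : ∀ C : ClassGroup (𝓞 K), H / (4 * q) ≤ Nat.card (𝓞 K)ˣ *
      ∑ a ∈ A with ClassGroup.mk0 a = C, (Ideal.absNorm (a : Ideal (𝓞 K)) : ℝ)⁻¹ := by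
    intro C
    obtain ⟨b, hbC, hbM⟩ := exists_ideal_in_class_of_norm_le (K := K) C⁻¹
    have hbq : (Ideal.absNorm (b : Ideal (𝓞 K)) : ℝ) ≤ q := by
      have hnc : InfinitePlace.nrComplexPlaces K = 1 := by
        have := IsTotallyComplex.finrank (K := K)
        omega
      refine hbM.trans (le_trans ?_ hq)
      rw [hnc, hdeg]
      have hs := Real.sqrt_nonneg d
      have hpi := Real.pi_gt_three
      -- The Minkowski constant here is 2/π.
      have : (4 / Real.pi) ^ 1 * (((2 : ℕ).factorial : ℝ) / ((2 : ℕ) : ℝ) ^ 2) ≤ 1 := by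
        norm_num [Nat.factorial]
        rw [div_mul_eq_mul_div, div_le_one (by linarith)]
        linarith
      push_cast at this ⊢
      simpa [mul_assoc] using mul_le_mul_of_nonneg_right this hs
    have hb0 : (b : Ideal (𝓞 K)) ≠ ⊥ := nonZeroDivisors.coe_ne_zero b
    have hbpos : (0 : ℝ) < Ideal.absNorm (b : Ideal (𝓞 K)) := by
      exact_mod_cast Nat.pos_of_ne_zero fun h => hb0 (Ideal.absNorm_eq_zero_iff.1 h)
    obtain ⟨S, hS, hsum⟩ := exists_finset_mem_ideal hdeg φ hω him0 hωq hb0 k₀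
    have h1 := sum_elementNorm_inv_le hdeg b S (fun α hα => ⟨(hS α hα).1, (hS α hα).2.1⟩)
      (A.filter fun a => ClassGroup.mk0 a = C) (by
        rintro a ha ⟨α, hα, hN⟩
        refine Finset.mem_filter.2 ⟨hA a ?_, by rw [ha, hbC, inv_inv]⟩
        have h2 := (hS α hα).2.2
        rw [← hN] at h2
        push_cast at h2
        set n : ℝ := (Ideal.absNorm (b : Ideal (𝓞 K)) : ℝ)
        have h3 : (Ideal.absNorm (a : Ideal (𝓞 K)) : ℝ) ≤ 4 * n * k₀ ^ 2 * q ^ 2 := by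
          refine le_of_mul_le_mul_left (h2.trans (le_of_eq ?_)) hbpos
          ring
        refine h3.trans ?_
        calc 4 * n * k₀ ^ 2 * q ^ 2 ≤ 4 * q * k₀ ^ 2 * q ^ 2 := by gcongr
          _ = _ := by ring)
    refine le_trans ?_ h1
    change H / _ ≤ _ at hsum
    refine le_trans (le_of_eq ?_) (mul_le_mul_of_nonneg_left hsum hbpos.le)
    generalize H = H
    field_simp
  have h2 := Finset.sum_le_sum fun C (_ : C ∈ (Finset.univ : Finset (ClassGroup (𝓞 K)))) => hclass C
  have h3 := Finset.sum_fiberwise A (fun a => ClassGroup.mk0 a)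
    fun a => (Ideal.absNorm (a : Ideal (𝓞 K)) : ℝ)⁻¹
  rw [Finset.sum_const, nsmul_eq_mul, ← Finset.mul_sum, h3] at h2
  refine le_trans (le_of_eq ?_) h2
  rw [mul_div_assoc]
  rfl

/-- An explicit lower bound for the harmonic sum over ideals. -/
theorem residue_mul_log_le_sum (hdeg : Module.finrank ℚ K = 2) [him : IsTotallyComplex K]
    {y : ℝ} (hy : 1024 * |(discr K : ℝ)| ^ 3 ≤ y) (A : Finset (Ideal (𝓞 K)))
    (hA : ∀ a : Ideal (𝓞 K), a ≠ 0 → (Ideal.absNorm a : ℝ) ≤ y → a ∈ A) :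
    dedekindZeta_residue K * Real.log y / (64 * Real.pi) ≤
      ∑ a ∈ A, (Ideal.absNorm a : ℝ)⁻¹ := by
  classical
  have hd := three_le_abs_discr (K := K) hdeg
  set d := |(discr K : ℝ)| with hddef
  set s := Real.sqrt d with hs
  have hs1 : 1 ≤ s := Real.one_le_sqrt.2 (by linarith)
  have hsd : s ^ 2 = d := Real.sq_sqrt (by linarith)
  set q : ℕ := ⌈s⌉₊ with hq
  have hsq : s ≤ q := Nat.le_ceil s
  have hqs : (q : ℝ) ≤ 2 * s := by linarith [Nat.ceil_lt_add_one (by linarith : (0 : ℝ) ≤ s)]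
  have hq0 : (0 : ℝ) < q := by linarith
  have hy0 : 0 < y := lt_of_lt_of_le (by positivity) hy
  have hq6 : 16 * (q : ℝ) ^ 6 ≤ y := by
    refine le_trans ?_ hy
    calc 16 * (q : ℝ) ^ 6 ≤ 16 * (2 * s) ^ 6 := by gcongr
      _ = 1024 * (s ^ 2) ^ 3 := by ring
      _ = _ := by rw [hsd]
  set k₀ : ℕ := ⌊Real.sqrt (y / (4 * q ^ 3))⌋₊ with hk₀
  have hk1 : (k₀ : ℝ) ≤ Real.sqrt (y / (4 * q ^ 3)) := Nat.floor_le (Real.sqrt_nonneg _)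
  have hk2 : Real.sqrt (y / (4 * q ^ 3)) ≤ k₀ + 1 := (Nat.lt_floor_add_one _).le
  have hky : 4 * (q : ℝ) ^ 3 * k₀ ^ 2 ≤ y := by
    have : (k₀ : ℝ) ^ 2 ≤ y / (4 * q ^ 3) := by
      rw [← Real.sq_sqrt (by positivity : 0 ≤ y / (4 * (q : ℝ) ^ 3))]
      gcongr
    rw [le_div_iff₀ (by positivity)] at this
    linarith
  -- From 16q⁶ ≤ y follows 4q³ ≤ √y, hence k₀ + 1 ≥ y^(1/4). The constant 1024 in the hypothesis is
  -- 16 · 2⁶, from q ≤ 2√|d_K|.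
  have hlog : Real.log y / 4 ≤ ∑ k ∈ Finset.range k₀, ((k : ℝ) + 1)⁻¹ := by
    have h1 := log_add_one_le_harmonic k₀
    have h2 : ((harmonic k₀ : ℚ) : ℝ) = ∑ k ∈ Finset.range k₀, ((k : ℝ) + 1)⁻¹ := by
      simp [harmonic]
    rw [← h2]
    refine le_trans ?_ h1
    have h3 : Real.log y / 4 = Real.log (Real.sqrt (Real.sqrt y)) := by
      rw [Real.log_sqrt (Real.sqrt_nonneg _), Real.log_sqrt hy0.le]
      ring
    rw [h3]
    have h4 : Real.sqrt (Real.sqrt y) ≤ Real.sqrt (y / (4 * q ^ 3)) := by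
      apply Real.sqrt_le_sqrt
      rw [le_div_iff₀ (by positivity)]
      have h5 : 4 * (q : ℝ) ^ 3 ≤ Real.sqrt y := by
        apply Real.le_sqrt_of_sq_le
        calc (4 * (q : ℝ) ^ 3) ^ 2 = 16 * (q : ℝ) ^ 6 := by ring
          _ ≤ y := hq6
      calc Real.sqrt y * (4 * q ^ 3) ≤ Real.sqrt y * Real.sqrt y := by gcongr
        _ = y := Real.mul_self_sqrt hy0.le
    refine Real.log_le_log (Real.sqrt_pos.2 (Real.sqrt_pos.2 hy0)) ?_
    push_cast
    exact h4.trans hk2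
  set A' : Finset (nonZeroDivisors (Ideal (𝓞 K))) := A.subtype _ with hA'
  have h1 := classNumber_mul_harmonic_le hdeg hsq k₀ A' (by
    intro a ha
    rw [hA', Finset.mem_subtype]
    exact hA a (nonZeroDivisors.coe_ne_zero a) (ha.trans hky))
  have h2 : ∑ a ∈ A', (Ideal.absNorm (a : Ideal (𝓞 K)) : ℝ)⁻¹ ≤
      ∑ a ∈ A, (Ideal.absNorm a : ℝ)⁻¹ := by
    have h3 := Finset.sum_map A' (Function.Embedding.subtype _)
      (fun a : Ideal (𝓞 K) => (Ideal.absNorm a : ℝ)⁻¹)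
    rw [hA', Finset.subtype_map] at h3
    refine h3.symm.le.trans ?_
    exact Finset.sum_le_sum_of_subset_of_nonneg (Finset.filter_subset _ _)
      fun _ _ _ => by positivity
  have hw : (0 : ℝ) < Nat.card (𝓞 K)ˣ := by
    rw [card_units_eq_torsionOrder hdeg]
    exact_mod_cast Nat.pos_of_ne_zero (Units.torsionOrder_ne_zero K)
  refine le_trans ?_ h2
  rw [residue_eq hdeg]
  rw [← hddef, ← hs]
  refine le_of_mul_le_mul_left (le_trans ?_ h1) hw
  have hh : (0 : ℝ) ≤ classNumber K := Nat.cast_nonneg _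
  have hlog0 : 0 ≤ Real.log y := by
    apply Real.log_nonneg
    refine le_trans ?_ hy
    have : (1 : ℝ) ≤ d ^ 3 := one_le_pow₀ (by linarith)
    linarith
  calc _ = classNumber K * (Real.log y / 4) / (4 * (2 * s)) := by
        have := Real.pi_pos
        field_simp
        ring
    _ ≤ _ := by gcongr

end IdealHarmonicSum

/-! ### Sieving prime pairs -/

section PrimePairs

variable {K : Type*} [Field K] [NumberField K]

/-- A box in `ℤ²` containing all `(x, y)` with `𝔑(x + yω) ≤ v`. -/
theorem exists_box (hdeg : Module.finrank ℚ K = 2) [him : IsTotallyComplex K]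
    (φ : K →+* ℂ) {ω : 𝓞 K} (hre : |(φ ω).re| ≤ 1 / 2)
    (him1 : 4 * (φ ω).im ^ 2 = |(discr K : ℝ)|) {v : ℝ} (hv : 0 ≤ v) :
    ∃ (a b : ℤ) (L₁ L₂ : ℕ), (L₁ : ℝ) ≤ 4 * Real.sqrt v + 3 ∧
      (L₂ : ℝ) ≤ 4 * (Real.sqrt v / Real.sqrt |(discr K : ℝ)|) + 3 ∧
      ∀ q, (elementNorm K (latticeHom ω q) : ℝ) ≤ v →
        q ∈ Finset.Ico a (a + L₁) ×ˢ Finset.Ico b (b + L₂) := by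
  have hd := three_le_abs_discr (K := K) hdeg
  set d := |(discr K : ℝ)|
  set s := Real.sqrt d with hs
  have hs1 : 1 ≤ s := Real.one_le_sqrt.2 (by linarith)
  have hsd : s ^ 2 = d := Real.sq_sqrt (by linarith)
  set r := Real.sqrt v with hr
  have hr0 : 0 ≤ r := Real.sqrt_nonneg v
  have hrv : r ^ 2 = v := Real.sq_sqrt hv
  have hrs0 : 0 ≤ r / s := by positivity
  set a := ⌈2 * r⌉₊
  set c := ⌈2 * (r / s)⌉₊
  have ha1 : 2 * r ≤ a := Nat.le_ceil _
  have ha2 : (a : ℝ) < 2 * r + 1 := Nat.ceil_lt_add_one (by positivity)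
  have hc1 : 2 * (r / s) ≤ c := Nat.le_ceil _
  have hc2 : (c : ℝ) < 2 * (r / s) + 1 := Nat.ceil_lt_add_one (by positivity)
  -- The extra 1 makes the half-open intervals contain their right endpoints `a` and `c`.
  refine ⟨-a, -c, 2 * a + 1, 2 * c + 1, by push_cast; linarith, by push_cast; linarith, ?_⟩
  intro q hq
  rw [elementNorm_eq_normSq hdeg φ, Complex.sq_norm, Complex.normSq_apply,
    (latticeHom_re_im φ ω q).1, (latticeHom_re_im φ ω q).2] at hq
  have hy : |(q.2 : ℝ)| ≤ 2 * (r / s) := by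
    refine abs_le_of_sq_le_sq ?_ (by positivity)
    rw [mul_pow, div_pow, hrv, hsd, mul_div_assoc', le_div_iff₀ (by linarith), ← him1]
    nlinarith [sq_nonneg ((q.1 : ℝ) + q.2 * (φ ω).re)]
  have hx : |(q.1 : ℝ)| ≤ 2 * r := by
    have h1 : |(q.1 : ℝ) + q.2 * (φ ω).re| ≤ r := by
      refine abs_le_of_sq_le_sq ?_ hr0
      rw [hrv]
      nlinarith [sq_nonneg ((q.2 : ℝ) * (φ ω).im)]
    have h2 : |(q.2 : ℝ) * (φ ω).re| ≤ r := by
      rw [abs_mul]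
      have h3 : r / s ≤ r := div_le_self hr0 hs1
      calc _ ≤ 2 * (r / s) * (1 / 2) := mul_le_mul hy hre (abs_nonneg _) (by positivity)
        _ ≤ r := by linarith
    rw [abs_le] at h1 h2 ⊢
    constructor <;> linarith [h1.1, h1.2, h2.1, h2.2]
  have hx' : |q.1| ≤ a := by exact_mod_cast hx.trans ha1
  have hy' : |q.2| ≤ c := by exact_mod_cast hy.trans hc1
  rw [abs_le] at hx' hy'
  rw [Finset.mem_product, Finset.mem_Ico, Finset.mem_Ico]
  push_cast
  refine ⟨⟨hx'.1, ?_⟩, ⟨hy'.1, ?_⟩⟩ <;> linarith [hx'.2, hy'.2]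

theorem elementNorm_eq_of_mem {α : 𝓞 K} (hα : Prime α) {p : Ideal (𝓞 K)} (hp : p.IsPrime)
    (hmem : α ∈ p) : elementNorm K α = Ideal.absNorm p := by
  have h1 : (Ideal.span {α}).IsPrime := (Ideal.span_singleton_prime hα.ne_zero).2 hα
  have h2 : (Ideal.span {α}).IsMaximal :=
    h1.isMaximal fun h => hα.ne_zero (Ideal.span_singleton_eq_bot.1 h)
  rw [elementNorm, h2.eq_of_le hp.ne_top ((Ideal.span_singleton_le_iff_mem _).2 hmem)]

/-- A prime element lying in `p` generates it, so α or tα + 1 has norm at most z. In the second case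
|tα| ≤ √z + 1 ≤ 2√z, while |t| ≥ 1 because N(t) is a positive integer. -/
theorem elementNorm_le_of_mem_prime (hdeg : Module.finrank ℚ K = 2) [him : IsTotallyComplex K]
    (φ : K →+* ℂ) {t α : 𝓞 K} (ht : t ≠ 0) (hα : Prime α) (htα : Prime (t * α + 1))
    {p : Ideal (𝓞 K)} (hp : p.IsPrime) {z : ℝ} (hz : 1 ≤ z) (hpz : (Ideal.absNorm p : ℝ) ≤ z)
    (hmem : α * (t * α + 1) ∈ p) : (elementNorm K α : ℝ) ≤ 4 * z := by
  rcases hp.mem_or_mem hmem with h | h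
  · rw [elementNorm_eq_of_mem hα hp h]
    linarith
  · have h1 : (elementNorm K (t * α + 1) : ℝ) ≤ z := by
      rw [elementNorm_eq_of_mem htα hp h]
      exact hpz
    have ht1 : (1 : ℝ) ≤ elementNorm K t := by
      have : elementNorm K t ≠ 0 := fun h0 => by
        rw [elementNorm, Ideal.absNorm_eq_zero_iff, Ideal.span_singleton_eq_bot] at h0
        exact ht h0
      exact_mod_cast Nat.one_le_iff_ne_zero.2 this
    rw [elementNorm_eq_normSq hdeg φ] at h1 ht1 ⊢
    have h2 : φ ((t * α + 1 : 𝓞 K) : K) = φ t * φ α + 1 := by simp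
    rw [h2] at h1
    set s := Real.sqrt z
    have hs1 : 1 ≤ s := Real.one_le_sqrt.2 hz
    have hs2 : s ^ 2 = z := Real.sq_sqrt (by linarith)
    have h3 : ‖φ t * φ α + 1‖ ≤ s := Real.le_sqrt_of_sq_le h1
    have h4 : 1 ≤ ‖φ t‖ := by
      by_contra h
      push Not at h
      nlinarith [norm_nonneg (φ t)]
    have h5 : ‖φ α‖ ≤ 2 * s := by
      calc ‖φ α‖ ≤ ‖φ t‖ * ‖φ α‖ := le_mul_of_one_le_left (norm_nonneg _) h4
        _ = ‖φ t * φ α + 1 - 1‖ := by rw [add_sub_cancel_right, norm_mul]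
        _ ≤ ‖φ t * φ α + 1‖ + ‖(1 : ℂ)‖ := norm_sub_le _ _
        _ ≤ s + 1 := by
          rw [norm_one]
          linarith
        _ ≤ 2 * s := by linarith
    calc _ ≤ (2 * s) ^ 2 := pow_le_pow_left₀ (norm_nonneg _) h5 2
      _ = 4 * z := by rw [mul_pow, hs2]; norm_num

/-- If `p` has norm two and does not contain `t`, it divides every `α(tα + 1)`. -/
theorem mul_mem_of_absNorm_eq_two {t : 𝓞 K} {p : Ideal (𝓞 K)} (hp : p.IsPrime)
    (hN : Ideal.absNorm p = 2) (ht : t ∉ p) (α : 𝓞 K) : α * (t * α + 1) ∈ p := by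
  have hp0 : p ≠ ⊥ := by
    rintro rfl
    simp at hN
  have hmax := hp.isMaximal hp0
  let _ := Ideal.Quotient.field p
  have := Ideal.finiteQuotientOfFreeOfNeBot p hp0
  have := Fintype.ofFinite (𝓞 K ⧸ p)
  have hcard : Fintype.card (𝓞 K ⧸ p) = 2 := by
    rw [← Nat.card_eq_fintype_card, natCard_quotient, hN]
  have hsq : ∀ x : 𝓞 K ⧸ p, x ^ 2 = x := fun x => by
    have := FiniteField.pow_card x
    rwa [hcard] at this
  rw [← Ideal.Quotient.eq_zero_iff_mem, map_mul, map_add, map_mul, map_one]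
  set r := Ideal.Quotient.mk p α
  set s := Ideal.Quotient.mk p t with hs
  have hs0 : s ≠ 0 := fun h => ht (Ideal.Quotient.eq_zero_iff_mem.1 h)
  -- The residue field is 𝔽₂, so t ≡ 1 and the polynomial becomes r(r + 1) = 0.
  have hs1 : s = 1 := mul_left_cancel₀ hs0 (by rw [← sq, hsq, mul_one])
  have h2 := hsq 2
  rw [hs1]
  linear_combination hsq r + r * h2

theorem prod_le_div_idealEulerPhi {t : 𝓞 K} (ht : t ≠ 0) (P : Finset (Ideal (𝓞 K)))
    (hP : ∀ p ∈ P, p.IsPrime ∧ p ≠ ⊥) [DecidablePred fun p : Ideal (𝓞 K) => t ∈ p] :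
    ∏ p ∈ P, (1 + if t ∈ p then 1 / ((Ideal.absNorm p : ℝ) - 1) else 0) ≤
      elementNorm K t / idealEulerPhi K (Ideal.span {t}) ∧
    0 < idealEulerPhi K (Ideal.span {t}) := by
  classical
  have hspan : Ideal.span {t} ≠ 0 := fun h => ht (Ideal.span_singleton_eq_bot.1 h)
  set Q := UniqueFactorizationMonoid.primeFactors (Ideal.span {t})
  have hQ : ∀ p ∈ Q, p.IsPrime ∧ t ∈ p := fun p hp => by
    rw [mem_primeFactors_iff hspan, Ideal.span_singleton_le_iff_mem] at hp
    exact hp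
  have hQN : ∀ p ∈ Q, (2 : ℝ) ≤ Ideal.absNorm p := fun p hp => by
    have hb : p ≠ ⊥ := by
      rintro rfl
      exact ht ((Submodule.mem_bot _).1 (hQ _ hp).2)
    exact_mod_cast two_le_absNorm (hQ p hp).1 hb
  have hNt : (0 : ℝ) < elementNorm K t := by
    have : elementNorm K t ≠ 0 := fun h0 => by
      rw [elementNorm, Ideal.absNorm_eq_zero_iff, Ideal.span_singleton_eq_bot] at h0
      exact ht h0
    exact_mod_cast Nat.pos_of_ne_zero this
  have hpos : ∀ p ∈ Q, 0 < 1 - 1 / (Ideal.absNorm p : ℝ) := fun p hp => by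
    have := hQN p hp
    rw [sub_pos, div_lt_one (by linarith)]
    linarith
  have hprod : 0 < ∏ p ∈ Q, (1 - 1 / (Ideal.absNorm p : ℝ)) := Finset.prod_pos hpos
  have hphi : idealEulerPhi K (Ideal.span {t}) =
      elementNorm K t * ∏ p ∈ Q, (1 - 1 / (Ideal.absNorm p : ℝ)) := rfl
  refine ⟨?_, by rw [hphi]; positivity⟩
  rw [hphi, div_mul_eq_div_div, div_self hNt.ne', one_div, ← Finset.prod_inv_distrib]
  have h1 : ∏ p ∈ P, (1 + if t ∈ p then 1 / ((Ideal.absNorm p : ℝ) - 1) else 0) =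
      ∏ p ∈ P.filter (t ∈ ·), (1 + 1 / ((Ideal.absNorm p : ℝ) - 1)) := by
    rw [Finset.prod_filter]
    refine Finset.prod_congr rfl fun p _ => ?_
    split_ifs <;> simp
  have hsub : P.filter (t ∈ ·) ⊆ Q := fun p hp => by
    obtain ⟨h2, h3⟩ := Finset.mem_filter.1 hp
    rw [mem_primeFactors_iff hspan, Ideal.span_singleton_le_iff_mem]
    exact ⟨(hP p h2).1, h3⟩
  have h2 : ∏ p ∈ P.filter (t ∈ ·), (1 + 1 / ((Ideal.absNorm p : ℝ) - 1)) =
      ∏ p ∈ P.filter (t ∈ ·), (1 - 1 / (Ideal.absNorm p : ℝ))⁻¹ := by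
    refine Finset.prod_congr rfl fun p hp => ?_
    have := hQN p (hsub hp)
    have h3 : (Ideal.absNorm p : ℝ) - 1 ≠ 0 := by linarith
    have h4 : (Ideal.absNorm p : ℝ) ≠ 0 := by linarith
    field_simp
    ring
  -- Prime divisors of `t` outside `P` only add factors that are at least 1.
  rw [h1, h2, ← Finset.prod_sdiff hsub]
  have h3 : 1 ≤ ∏ p ∈ Q \ P.filter (t ∈ ·), (1 - 1 / (Ideal.absNorm p : ℝ))⁻¹ :=
    one_le_prod_of_one_le fun p hp => by
      have h5 := hQN p (Finset.mem_sdiff.1 hp).1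
      refine (one_le_inv₀ (hpos p (Finset.mem_sdiff.1 hp).1)).2 ?_
      have : (0 : ℝ) ≤ 1 / (Ideal.absNorm p : ℝ) := by positivity
      linarith
  exact le_mul_of_one_le_left (Finset.prod_nonneg fun p hp =>
    inv_nonneg.2 (hpos p (hsub hp)).le) h3

/-- The set of nonzero prime ideals of norm at most `z`. -/
theorem exists_primes_finset (K : Type*) [Field K] [NumberField K] (z : ℝ) :
    ∃ P : Finset (Ideal (𝓞 K)), ∀ p, p ∈ P ↔
      p.IsPrime ∧ p ≠ ⊥ ∧ (Ideal.absNorm p : ℝ) ≤ z := by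
  have hfin : {p : Ideal (𝓞 K) | p.IsPrime ∧ p ≠ ⊥ ∧ (Ideal.absNorm p : ℝ) ≤ z}.Finite := by
    refine (Ideal.finite_setOfPred_absNorm_le (S := 𝓞 K) ⌊z⌋₊).subset fun p hp => ?_
    exact Nat.le_floor hp.2.2
  exact ⟨hfin.toFinset, fun p => by simp⟩

/-- The lower bound for the denominator in Selberg's sieve. -/
theorem sq_residue_mul_log_le (hdeg : Module.finrank ℚ K = 2) [him : IsTotallyComplex K]
    {t : 𝓞 K} (ht : t ≠ 0) (h2 : ∀ p : Ideal (𝓞 K), p.IsPrime → p ≠ ⊥ → t ∉ p →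
      3 ≤ Ideal.absNorm p) {y : ℝ} (hy : 1024 * |(discr K : ℝ)| ^ 3 ≤ y) (hy1 : 1 ≤ y)
    (P : Finset (Ideal (𝓞 K))) (hP : ∀ p, p ∈ P ↔
      p.IsPrime ∧ p ≠ ⊥ ∧ (Ideal.absNorm p : ℝ) ≤ y ^ 2) :
    (dedekindZeta_residue K * Real.log y / (64 * Real.pi)) ^ 2 ≤
      levelSum P (fun p => (Ideal.absNorm p : ℝ)) (fun p => (rootCount t p / Ideal.absNorm p : ℝ) /
        (1 - rootCount t p / Ideal.absNorm p)) (y ^ 2) *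
      (elementNorm K t / idealEulerPhi K (Ideal.span {t})) := by
  classical
  have hA : {a : Ideal (𝓞 K) | a ≠ 0 ∧ (Ideal.absNorm a : ℝ) ≤ y}.Finite := by
    refine (Ideal.finite_setOfPred_absNorm_le (S := 𝓞 K) ⌊y⌋₊).subset fun p hp => ?_
    exact Nat.le_floor hp.2
  have hyy : y ≤ y ^ 2 := le_self_pow₀ hy1 two_ne_zero
  have hPp : ∀ p ∈ P, p.IsPrime ∧ p ≠ ⊥ := fun p hp => ⟨((hP p).1 hp).1, ((hP p).1 hp).2.1⟩
  have hPN : ∀ p ∈ P, (2 : ℝ) ≤ Ideal.absNorm p := fun p hp => by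
    exact_mod_cast two_le_absNorm (hPp p hp).1 (hPp p hp).2
  have h1 := residue_mul_log_le_sum hdeg hy hA.toFinset fun a h3 h4 => by
    simpa [h4] using h3
  have h3 := sum_absNorm_inv_le_levelSum hA.toFinset P (y := y) (fun a ha => by simpa using ha) hPp
    fun p h4 h5 h6 => (hP p).2 ⟨h4, h5, h6.trans hyy⟩
  have h13 := h1.trans h3
  have h0 : 0 ≤ dedekindZeta_residue K * Real.log y / (64 * Real.pi) := by
    have := (dedekindZeta_residue_pos K).le
    have := Real.log_nonneg hy1
    have := Real.pi_pos
    positivity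
  have hh : ∀ p ∈ P, 0 ≤ (rootCount t p / Ideal.absNorm p : ℝ) /
      (1 - rootCount t p / Ideal.absNorm p) := fun p hp => by
    have hN := hPN p hp
    refine div_nonneg (by positivity) ?_
    rw [sub_nonneg, div_le_one (by linarith)]
    exact_mod_cast rootCount_le_absNorm t (hPp p hp).1 (hPp p hp).2
  -- The correction `c` is supported on primes dividing `t`, where there is one root and the local
  -- comparison is an equality. At other primes it reads N(N - 2) ≤ (N - 1)², and N ≥ 3 keeps the
  -- denominator positive.
  have h4 := levelSum_mul_le P (fun p => (Ideal.absNorm p : ℝ))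
    (fun p => 1 / ((Ideal.absNorm p : ℝ) - 1))
    (fun p => (rootCount t p / Ideal.absNorm p : ℝ) / (1 - rootCount t p / Ideal.absNorm p))
    (fun p => if t ∈ p then 1 / ((Ideal.absNorm p : ℝ) - 1) else 0)
    (fun p hp => by linarith [hPN p hp])
    (fun p hp => div_nonneg zero_le_one (by linarith [hPN p hp]))
    hh
    (fun p hp => by
      split_ifs
      · exact div_nonneg zero_le_one (by linarith [hPN p hp])
      · exact le_rfl)
    (fun p hp => by
      have hN := hPN p hp
      have e1 : (Ideal.absNorm p : ℝ) - 1 ≠ 0 := by linarith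
      have e2 : (Ideal.absNorm p : ℝ) ≠ 0 := by linarith
      unfold rootCount
      split_ifs with htp
      · apply le_of_eq
        push_cast
        field_simp
      · have h3N : (3 : ℝ) ≤ Ideal.absNorm p := by
          exact_mod_cast h2 p (hPp p hp).1 (hPp p hp).2 htp
        push_cast
        set N : ℝ := (Ideal.absNorm p : ℝ)
        have e3 : N - 2 ≠ 0 := by linarith
        have e4 : (1 + 1 / (N - 1)) ^ 2 = N ^ 2 / (N - 1) ^ 2 := by
          field_simp
          ring
        have e5 : (1 + 2 / N / (1 - 2 / N)) * (1 + 0) = N / (N - 2) := by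
          have : (1 : ℝ) - 2 / N = (N - 2) / N := by field_simp
          rw [this]
          field_simp
          ring
        rw [e4, e5, div_le_div_iff₀ (by positivity) (by linarith)]
        nlinarith)
    (x := y) (y := y) (by linarith) (by linarith)
  rw [← sq, ← sq] at h4
  refine (pow_le_pow_left₀ h0 h13 2).trans (h4.trans ?_)
  exact mul_le_mul_of_nonneg_left (prod_le_div_idealEulerPhi ht P hPp).1
    (levelSum_nonneg hh _)

/-- The sieve bound for points of a box. -/
theorem card_sifted_box_le {ω : 𝓞 K} (hω : ∀ α : 𝓞 K, ∃ x y : ℤ, α = x + y * ω) (t : 𝓞 K)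
    (h2 : ∀ p : Ideal (𝓞 K), p.IsPrime → p ≠ ⊥ → t ∉ p → 3 ≤ Ideal.absNorm p)
    {z : ℝ} (hz : 1 ≤ z) (P : Finset (Ideal (𝓞 K))) (hP : ∀ p ∈ P, p.IsPrime ∧ p ≠ ⊥)
    (a b : ℤ) (L₁ L₂ : ℕ) (B : Finset (ℤ × ℤ))
    (hB : ∀ q, q ∈ B ↔ q ∈ Finset.Ico a (a + L₁) ×ˢ Finset.Ico b (b + L₂) ∧
      ∀ p ∈ P, latticeHom ω q * (t * latticeHom ω q + 1) ∉ p) :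
    (B.card : ℝ) ≤ L₁ * L₂ / levelSum P (fun p => (Ideal.absNorm p : ℝ))
      (fun p => (rootCount t p / Ideal.absNorm p : ℝ) /
        (1 - rootCount t p / Ideal.absNorm p)) z + z ^ 4 * (z ^ 2 * (L₁ + L₂ + z ^ 2)) := by
  classical
  have hPN : ∀ p ∈ P, (2 : ℝ) ≤ Ideal.absNorm p := fun p hp => by
    exact_mod_cast two_le_absNorm (hP p hp).1 (hP p hp).2
  have hr : ∀ p : Ideal (𝓞 K), (1 : ℝ) ≤ rootCount t p := fun p => by
    exact_mod_cast rootCount_pos t p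
  set box := Finset.Ico a (a + L₁) ×ˢ Finset.Ico b (b + L₂)
  set 𝒟 : ℤ × ℤ → Finset (Ideal (𝓞 K)) := fun q =>
    P.filter fun p => latticeHom ω q * (t * latticeHom ω q + 1) ∈ p with h𝒟
  have h := selberg_sieve (P := P) (N := fun p => (Ideal.absNorm p : ℝ))
    (g := fun p => (rootCount t p / Ideal.absNorm p : ℝ)) (z := z) box 𝒟 hPN
    (fun p hp => div_pos (by linarith [hr p]) (by linarith [hPN p hp]))
    (fun p hp => by
      rw [div_lt_one (by linarith [hPN p hp])]
      have h3 := two_le_absNorm (hP p hp).1 (hP p hp).2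
      have h4 := h2 p (hP p hp).1 (hP p hp).2
      have : rootCount t p < Ideal.absNorm p := by
        unfold rootCount
        split_ifs with htp
        · omega
        · have := h4 htp
          omega
      exact_mod_cast this)
    (fun p hp => by
      rw [inv_div]
      exact div_le_self (by linarith [hPN p hp]) (hr p)) hz
    (X := L₁ * L₂) (R := z ^ 2 * (L₁ + L₂ + z ^ 2)) (fun D hD hDz => by
      refine (abs_card_sifted_sub_le hω t D (fun p hp => hP p (hD hp)) a b L₁ L₂ _
        fun q => ?_).trans ?_
      · rw [Finset.mem_filter]
        refine and_congr Iff.rfl ⟨fun h p hp => (Finset.mem_filter.1 (h hp)).2,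
          fun h p hp => Finset.mem_filter.2 ⟨hD hp, h p hp⟩⟩
      · have : 0 ≤ ∏ p ∈ D, (Ideal.absNorm p : ℝ) := Finset.prod_nonneg fun _ _ => by positivity
        gcongr)
  refine le_trans (le_of_eq ?_) h
  congr 2
  ext q
  rw [hB, Finset.mem_filter]
  refine and_congr Iff.rfl ?_
  rw [Finset.eq_empty_iff_forall_notMem]
  simp only [h𝒟, Finset.mem_inter, Finset.mem_filter, not_and]
  exact ⟨fun h p hp hpP => h p hpP hp.2, fun h p hp hmem => h p ⟨hp, hmem⟩ hp⟩

/-- The set of prime pairs is finite, of size at most the number of sifted points of a box plus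
the number of points of a small box. -/
theorem primePairSet_bound (hdeg : Module.finrank ℚ K = 2) [him : IsTotallyComplex K]
    {t : 𝓞 K} (ht : t ≠ 0) {w : ℝ} (hw : 1024 * |(discr K : ℝ)| ^ 3 ≤ w) :
    (primePairSet K t (w ^ 80)).Finite ∧ ((primePairSet K t (w ^ 80)).ncard : ℝ) ≤
      (4 * w ^ 40 + 3) * (4 * (w ^ 40 / Real.sqrt |(discr K : ℝ)|) + 3) *
        ((elementNorm K t / idealEulerPhi K (Ideal.span {t})) /
          (dedekindZeta_residue K * Real.log w / (64 * Real.pi)) ^ 2) +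
      w ^ 12 * (8 * w ^ 40 + 6 + w ^ 4) + (8 * w + 3) ^ 2 := by
  classical
  have hd := three_le_abs_discr (K := K) hdeg
  have hw2 : 2 ≤ w := by
    refine le_trans ?_ hw
    have : (1 : ℝ) ≤ |(discr K : ℝ)| ^ 3 := one_le_pow₀ (by linarith)
    linarith
  have hw0 : 0 ≤ w := by linarith
  have hs1 : 1 ≤ Real.sqrt |(discr K : ℝ)| := Real.one_le_sqrt.2 (by linarith)
  let φ : K →+* ℂ := Classical.choice inferInstance
  obtain ⟨ω, hω, hre, him1⟩ := exists_generator hdeg φ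
  have hsurj : ∀ α : 𝓞 K, ∃ q, latticeHom ω q = α := fun α => by
    obtain ⟨x, y, h⟩ := hω α
    exact ⟨(x, y), h.symm⟩
  obtain ⟨a, b, L₁, L₂, hL₁, hL₂, hbox⟩ := exists_box hdeg φ hre him1 (v := w ^ 80) (by positivity)
  -- The second box holds the exceptional α, of norm at most 4z with sieve level z = w².
  obtain ⟨a', b', L₁', L₂', hL₁', hL₂', hbox'⟩ :=
    exists_box hdeg φ hre him1 (v := 4 * w ^ 2) (by positivity)
  have hsq : Real.sqrt (w ^ 80) = w ^ 40 := by
    rw [show w ^ 80 = (w ^ 40) ^ 2 by ring]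
    exact Real.sqrt_sq (by positivity)
  have hsq' : Real.sqrt (4 * w ^ 2) = 2 * w := by
    rw [show 4 * w ^ 2 = (2 * w) ^ 2 by ring]
    exact Real.sqrt_sq (by positivity)
  rw [hsq] at hL₁ hL₂
  rw [hsq'] at hL₁' hL₂'
  obtain ⟨P, hP⟩ := exists_primes_finset K (w ^ 2)
  have hPp : ∀ p ∈ P, p.IsPrime ∧ p ≠ ⊥ := fun p hp => ⟨((hP p).1 hp).1, ((hP p).1 hp).2.1⟩
  set small := Finset.Ico a' (a' + L₁') ×ˢ Finset.Ico b' (b' + L₂')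
  set B := (Finset.Ico a (a + L₁) ×ˢ Finset.Ico b (b + L₂)).filter fun q =>
    ∀ p ∈ P, latticeHom ω q * (t * latticeHom ω q + 1) ∉ p with hB
  have hBmem : ∀ q, q ∈ B ↔ q ∈ Finset.Ico a (a + L₁) ×ˢ Finset.Ico b (b + L₂) ∧
      ∀ p ∈ P, latticeHom ω q * (t * latticeHom ω q + 1) ∉ p := fun q => Finset.mem_filter
  have hsub : primePairSet K t (w ^ 80) ⊆ ((B ∪ small).image (latticeHom ω) : Finset (𝓞 K)) := by
    intro α hα
    obtain ⟨q, rfl⟩ := hsurj α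
    obtain ⟨-, h2, h3, h4⟩ := hα
    rw [Finset.mem_coe]
    refine Finset.mem_image_of_mem _ (Finset.mem_union.2 ?_)
    by_cases h5 : ∀ p ∈ P, latticeHom ω q * (t * latticeHom ω q + 1) ∉ p
    · exact Or.inl ((hBmem q).2 ⟨hbox q h2, h5⟩)
    · push Not at h5
      obtain ⟨p, hp, hpm⟩ := h5
      exact Or.inr (hbox' q (elementNorm_le_of_mem_prime hdeg φ ht h3 h4 (hPp p hp).1
        (one_le_pow₀ (by linarith)) ((hP p).1 hp).2.2 hpm))
  have hfin := (Finset.finite_toSet ((B ∪ small).image (latticeHom ω))).subset hsub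
  refine ⟨hfin, ?_⟩
  have hcard : ((primePairSet K t (w ^ 80)).ncard : ℝ) ≤ B.card + small.card := by
    have h1 := Set.ncard_le_ncard hsub (Finset.finite_toSet _)
    rw [Set.ncard_coe_finset] at h1
    exact_mod_cast h1.trans (Finset.card_image_le.trans (Finset.card_union_le _ _))
  have hsmall : (small.card : ℝ) ≤ (8 * w + 3) ^ 2 := by
    have : small.card = L₁' * L₂' := by simp [small]
    rw [this, Nat.cast_mul, sq]
    have h1 : 2 * w / Real.sqrt |(discr K : ℝ)| ≤ 2 * w := div_le_self (by linarith) hs1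
    exact mul_le_mul (by linarith) (by linarith) (by positivity) (by linarith)
  refine hcard.trans ?_
  refine add_le_add ?_ hsmall
  have hphi := (prod_le_div_idealEulerPhi ht P hPp).2
  have hlog : 0 < Real.log w := Real.log_pos (by linarith)
  have hres := dedekindZeta_residue_pos K
  have hpi := Real.pi_pos
  set τ : ℝ := elementNorm K t / idealEulerPhi K (Ideal.span {t})
  have hτ0 : 0 ≤ τ := by positivity
  set Λ : ℝ := dedekindZeta_residue K * Real.log w / (64 * Real.pi)
  have hΛ : 0 < Λ := by positivity
  by_cases h2 : ∀ p : Ideal (𝓞 K), p.IsPrime → p ≠ ⊥ → t ∉ p → 3 ≤ Ideal.absNorm p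
  · have h3 := card_sifted_box_le hω t h2 (z := w ^ 2) (one_le_pow₀ (by linarith)) P hPp a b L₁ L₂
      B hBmem
    have h4 := sq_residue_mul_log_le hdeg ht h2 hw (by linarith) P hP
    set G := levelSum P (fun p => (Ideal.absNorm p : ℝ))
      (fun p => (rootCount t p / Ideal.absNorm p : ℝ) / (1 - rootCount t p / Ideal.absNorm p))
      (w ^ 2)
    change Λ ^ 2 ≤ G * τ at h4
    refine h3.trans (add_le_add ?_ ?_)
    · have hG : 0 < G := by
        by_contra h
        push Not at h
        nlinarith [sq_pos_of_pos hΛ]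
      have h5 : 1 / G ≤ τ / Λ ^ 2 := by
        rw [div_le_div_iff₀ hG (by positivity)]
        linarith
      rw [div_eq_mul_one_div]
      have h6 : 0 ≤ 1 / G := by positivity
      have h7 : 0 ≤ w ^ 40 / Real.sqrt |(discr K : ℝ)| := by positivity
      exact mul_le_mul (mul_le_mul hL₁ hL₂ (by positivity) (by positivity)) h5 h6 (by positivity)
    · have h1 : w ^ 40 / Real.sqrt |(discr K : ℝ)| ≤ w ^ 40 := div_le_self (by positivity) hs1
      calc (w ^ 2) ^ 4 * ((w ^ 2) ^ 2 * (L₁ + L₂ + (w ^ 2) ^ 2))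
          = w ^ 12 * (L₁ + L₂ + w ^ 4) := by ring
        _ ≤ _ := mul_le_mul_of_nonneg_left (by linarith) (by positivity)
  -- Some prime of norm 2 avoids `t`; it divides every value, so nothing survives the sieve.
  · push Not at h2
    obtain ⟨p, hp, hp0, htp, hN⟩ := h2
    have hN2 : Ideal.absNorm p = 2 := by
      have := two_le_absNorm hp hp0
      omega
    have hpP : p ∈ P := by
      refine (hP p).2 ⟨hp, hp0, ?_⟩
      rw [hN2]
      push_cast
      nlinarith
    have hBe : B = ∅ := by
      rw [Finset.eq_empty_iff_forall_notMem]
      intro q hq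
      exact ((hBmem q).1 hq).2 p hpP (mul_mem_of_absNorm_eq_two hp hN2 htp _)
    rw [hBe]
    simp only [Finset.card_empty, Nat.cast_zero]
    positivity

end PrimePairs

/-! ### Choice of parameters and constants -/

/-- `K` is an imaginary quadratic field (degree 2 with no real place), `t` a non-zero non-unit of
its ring of integers, and `dedekindZeta_residue K` is the residue at `s = 1` of the Dedekind zeta
function of `K`. -/
theorem proposition4p6 (K : Type*) [Field K] [NumberField K]
    (hdeg : Module.finrank ℚ K = 2) (him : IsTotallyComplex K)
    (t : 𝓞 K) (ht0 : t ≠ 0) (htu : ¬ IsUnit t)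
    (u : ℝ) (hu : 2 * Real.exp (8 * 10 ^ 45 * |(discr K : ℝ)|) ≤ u) :
    (primePairSet K t u).Finite ∧
      ((primePairSet K t u).ncard : ℝ) ≤
        (2 * 10 ^ 10 / (Real.sqrt |(discr K : ℝ)| * dedekindZeta_residue K ^ 2)) *
            ((elementNorm K t : ℝ) * u /
              (idealEulerPhi K (Ideal.span {t}) * Real.log (u ^ (1 / 4 : ℝ) / 2) ^ 2)) +
          10 ^ 30 * u ^ (3 / 4 : ℝ) := by
  classical
  have hd := three_le_abs_discr (K := K) hdeg
  set d := |(discr K : ℝ)| with hddef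
  have hu0 : 0 < u := lt_of_lt_of_le (by positivity) hu
  -- With z = w², the sieve error z⁶ · u^(1/2) is of order w^52, below w^60 = u^(3/4).
  set w : ℝ := u ^ (1 / 80 : ℝ) with hwdef
  have hw0 : 0 < w := Real.rpow_pos_of_pos hu0 _
  have hwpow : ∀ k : ℕ, w ^ k = u ^ ((k : ℝ) / 80) := fun k => by
    rw [hwdef, ← Real.rpow_natCast, ← Real.rpow_mul hu0.le]
    ring_nf
  have hw80 : w ^ 80 = u := by
    rw [hwpow]
    norm_num
  have hw20 : u ^ (1 / 4 : ℝ) = w ^ 20 := by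
    rw [hwpow]
    norm_num
  have hw60 : u ^ (3 / 4 : ℝ) = w ^ 60 := by
    rw [hwpow]
    norm_num
  -- Taking 80th roots in the bound on `u` gives w ≥ exp(10^44 d); the cubic Taylor term suffices.
  have hwd : 1024 * d ^ 3 ≤ w := by
    have h1 : Real.exp (8 * 10 ^ 45 * d) ≤ w ^ 80 := by
      rw [hw80]
      linarith [Real.exp_pos (8 * 10 ^ 45 * d)]
    have h2 : Real.exp (10 ^ 44 * d) ^ 80 = Real.exp (8 * 10 ^ 45 * d) := by
      rw [← Real.exp_nat_mul]
      congr 1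
      push_cast
      ring
    rw [← h2] at h1
    have h3 : Real.exp (10 ^ 44 * d) ≤ w := le_of_pow_le_pow_left₀ (by norm_num) hw0.le h1
    have h4 := Real.pow_div_factorial_le_exp (10 ^ 44 * d) (by positivity) 3
    refine le_trans ?_ (h4.trans h3)
    have h5 : (10 ^ 44 * d) ^ 3 / (Nat.factorial 3 : ℝ) = 10 ^ 132 / 6 * d ^ 3 := by
      norm_num [Nat.factorial]
      ring
    rw [h5]
    have : (0 : ℝ) < d ^ 3 := by positivity
    gcongr
    norm_num
  obtain ⟨hfin, hcard⟩ := primePairSet_bound hdeg ht0 hwd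
  rw [hw80] at hfin hcard
  refine ⟨hfin, hcard.trans ?_⟩
  rw [← hddef, hw20, hw60, ← hw80]
  have hd3 : d ≤ d ^ 3 := le_self_pow₀ (by linarith) (by norm_num)
  have hwd1 : 1024 * d ≤ w := by linarith
  have hw1 : 1 ≤ w := by linarith
  set s := Real.sqrt d with hs
  have hs1 : 1 ≤ s := Real.one_le_sqrt.2 (by linarith)
  have hsd : s ^ 2 = d := Real.sq_sqrt (by linarith)
  have hws : 3 * s ≤ w ^ 40 := by
    have h1 : w ≤ w ^ 40 := le_self_pow₀ hw1 (by norm_num)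
    nlinarith
  have hlogw : 0 < Real.log w := Real.log_pos (by linarith)
  have hphi := (prod_le_div_idealEulerPhi ht0 ∅ (by simp)).2
  have hNt : (0 : ℝ) ≤ elementNorm K t := Nat.cast_nonneg _
  have hres := dedekindZeta_residue_pos K
  set ρ := dedekindZeta_residue K
  set ϕ := idealEulerPhi K (Ideal.span {t})
  set n : ℝ := (elementNorm K t : ℝ)
  have hpi := Real.pi_pos
  have hpi2 : Real.pi ^ 2 ≤ 10 := by nlinarith [Real.pi_lt_d2]
  rw [add_assoc]
  refine add_le_add ?_ ?_
  · set ℓ := Real.log (w ^ 20 / 2) with hℓ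
    have hw2 : 2 < w ^ 20 := by
      have h1 : w ≤ w ^ 20 := le_self_pow₀ hw1 (by norm_num)
      linarith
    have hℓ0 : 0 < ℓ := Real.log_pos (by linarith)
    have hℓw : ℓ ≤ 20 * Real.log w := by
      rw [hℓ, Real.log_div (by positivity) two_ne_zero, Real.log_pow]
      have := Real.log_pos one_lt_two
      push_cast
      linarith
    have hbox : (4 * w ^ 40 + 3) * (4 * (w ^ 40 / s) + 3) ≤ 25 * (w ^ 80 / s) := by
      have h1 : 3 ≤ w ^ 40 / s := by
        rw [le_div_iff₀ (by linarith)]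
        linarith
      have h2 : 3 ≤ w ^ 40 := by linarith
      calc _ ≤ (5 * w ^ 40) * (5 * (w ^ 40 / s)) :=
            mul_le_mul (by linarith) (by linarith) (by linarith) (by positivity)
        _ = _ := by ring
    have hlog2 : (Real.log w ^ 2)⁻¹ ≤ 400 * (ℓ ^ 2)⁻¹ := by
      have h1 : ℓ ^ 2 ≤ 400 * Real.log w ^ 2 := by
        calc ℓ ^ 2 ≤ (20 * Real.log w) ^ 2 := pow_le_pow_left₀ hℓ0.le hℓw 2
          _ = _ := by ring
      rw [← div_eq_mul_inv, inv_eq_one_div, div_le_div_iff₀ (by positivity) (by positivity)]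
      linarith
    have hM : 0 ≤ w ^ 80 / s * (n / ϕ) * (ρ ^ 2)⁻¹ :=
      mul_nonneg (mul_nonneg (div_nonneg (pow_nonneg hw0.le 80) (by linarith))
        (div_nonneg hNt hphi.le)) (inv_nonneg.2 (sq_nonneg ρ))
    -- The constants are 25 from the box, (64π)² from the harmonic sum, with π² ≤ 10, and 400 = 20²
    -- from log(u^(1/4)/2) ≤ 20 log w; their product is 409600000.
    calc _ ≤ 25 * (w ^ 80 / s) * (n / ϕ / (ρ * Real.log w / (64 * Real.pi)) ^ 2) :=
          mul_le_mul_of_nonneg_right hbox (by positivity)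
      _ = 102400 * Real.pi ^ 2 * (w ^ 80 / s * (n / ϕ) * (ρ ^ 2)⁻¹) * (Real.log w ^ 2)⁻¹ := by
          field_simp
          ring
      _ ≤ 102400 * 10 * (w ^ 80 / s * (n / ϕ) * (ρ ^ 2)⁻¹) * (400 * (ℓ ^ 2)⁻¹) := by
          generalize w ^ 80 / s * (n / ϕ) * (ρ ^ 2)⁻¹ = M at hM
          refine mul_le_mul ?_ hlog2 (by positivity) (by positivity)
          exact mul_le_mul_of_nonneg_right (by linarith) hM
      _ = 409600000 * (w ^ 80 / s * (n / ϕ) * (ρ ^ 2)⁻¹ * (ℓ ^ 2)⁻¹) := by ring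
      _ ≤ 2 * 10 ^ 10 * (w ^ 80 / s * (n / ϕ) * (ρ ^ 2)⁻¹ * (ℓ ^ 2)⁻¹) := by
          exact mul_le_mul_of_nonneg_right (by norm_num)
            (mul_nonneg hM (inv_nonneg.2 (sq_nonneg ℓ)))
      _ = _ := by
          field_simp
  · have h40 : 1 ≤ w ^ 40 := one_le_pow₀ hw1
    have h4 : w ^ 4 ≤ w ^ 40 := pow_le_pow_right₀ hw1 (by norm_num)
    have h52 : w ^ 52 ≤ w ^ 60 := pow_le_pow_right₀ hw1 (by norm_num)
    have h2 : w ^ 2 ≤ w ^ 60 := pow_le_pow_right₀ hw1 (by norm_num)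
    have h60 : 0 < w ^ 60 := by positivity
    calc w ^ 12 * (8 * w ^ 40 + 6 + w ^ 4) + (8 * w + 3) ^ 2
        ≤ w ^ 12 * (15 * w ^ 40) + (11 * w) ^ 2 := by
          gcongr
          · linarith
          · linarith
      _ = 15 * w ^ 52 + 121 * w ^ 2 := by ring
      _ ≤ 15 * w ^ 60 + 121 * w ^ 60 := by gcongr
      _ ≤ 10 ^ 30 * w ^ 60 := by nlinarith
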